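/- Let $g$ be a smooth flat Riemannian metric on $\mathbb R^3$ (its Riemann curvature tensor vanishes), fix an orientation of $\mathbb R^3$ with Hodge star $\ast$ of $g$, and let $\xi$ be a smooth contact structure on $\mathbb R^3$ adapted to $g$: there are a smooth contact form $\alpha$ with $\xi=\ker\alpha$ and a constant $\lambda\neq 0$ such that $$d\alpha = 2\lambda \ast\alpha,\qquad g(\alpha,\alpha)=1 .$$ Let $g_0=dx^2+dy^2+dz^2$ be the standard flat metric and $\alpha_0=\sin(2\lambda z)\,dx+\cos(2\lambda z)\,dy$ the standard contact form. Then for every such $\alpha$ and $\lambda$: 1. there is a local diffeomorphism $\phi:\mathbb R^3\to\mathbb R^3$ with $\phi^*g_0=g$ and $\phi^*\alpha_0=\alpha$; in particular every point has a neighbourhood that is contact isometric to an open subset of the standard structure; 2. if $g$ is complete, then $(\mathbb R^3,g,\alpha)$ is contact isometric to $(\mathbb R^3,g_0,\alpha_0)$: there is a diffeomorphism $\phi:\mathbb R^3\to\mathbb R^3$ with $\phi^*g_0=g$ and $\phi^*\alpha_0=\alpha$. -/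

import Mathlib

open scoped ContDiff Manifold

noncomputable section

namespace ContactR3

/-- The manifold `ℝ³`. Its tangent space at every point is identified with `ℝ³` itself; the
Euclidean inner product of this type plays a role only through `stdMetric` and as a normalisation
of the orientations in `RMetric.vol`. -/
abbrev R3 : Type := EuclideanSpace ℝ (Fin 3)

instance factFinrankR3 : Fact (Module.finrank ℝ R3 = 3) := ⟨finrank_euclideanSpace_fin⟩

/-- The coordinate vector field `∂ᵢ` (a constant vector). -/
def coordVec (i : Fin 3) : R3 := EuclideanSpace.single i 1

/-- A smooth Riemannian metric on `ℝ³`, not necessarily complete. -/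
structure RMetric where
  /-- the scalar product `g_x(u, v)` -/
  inner : R3 → R3 →L[ℝ] R3 →L[ℝ] ℝ
  symm : ∀ x u v, inner x u v = inner x v u
  pos : ∀ x v, v ≠ 0 → 0 < inner x v v
  smooth : ContDiff ℝ ∞ inner

namespace RMetric

variable (g : RMetric)

/-- The matrix `g_{ij}` of the metric in the coordinates of `ℝ³`. -/
def gram (x : R3) : Matrix (Fin 3) (Fin 3) ℝ :=
  Matrix.of fun i j => g.inner x (coordVec i) (coordVec j)

/-- The partial derivative `∂_l g_{ij}`. -/
def dGram (l i j : Fin 3) (x : R3) : ℝ :=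
  fderiv ℝ (fun y => g.gram y i j) x (coordVec l)

/-- The Christoffel symbol
`Γ^k_{ij} = ½ ∑_l g^{kl} (∂_i g_{jl} + ∂_j g_{il} - ∂_l g_{ij})`. -/
def christoffel (k i j : Fin 3) (x : R3) : ℝ :=
  (1 / 2 : ℝ) * ∑ l, (g.gram x)⁻¹ k l * (g.dGram i j l x + g.dGram j i l x - g.dGram l i j x)

/-- The component `R^l_{kij}` of the Riemann curvature tensor,
`R(∂ᵢ, ∂ⱼ) ∂ₖ = ∑_l R^l_{kij} ∂_l`:
`∂_i Γ^l_{jk} - ∂_j Γ^l_{ik} + ∑_m (Γ^l_{im} Γ^m_{jk} - Γ^l_{jm} Γ^m_{ik})`. -/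
def riemann (l k i j : Fin 3) (x : R3) : ℝ :=
  fderiv ℝ (g.christoffel l j k) x (coordVec i) - fderiv ℝ (g.christoffel l i k) x (coordVec j)
    + ∑ m, (g.christoffel l i m x * g.christoffel m j k x
      - g.christoffel l j m x * g.christoffel m i k x)

/-- A metric is flat if its Riemann curvature tensor vanishes identically. -/
def IsFlat : Prop := ∀ l k i j x, g.riemann l k i j x = 0

/-- A smooth curve `γ : ℝ → ℝ³` is a geodesic if
`γ̈^k + ∑_{i,j} Γ^k_{ij}(γ) γ̇^i γ̇^j = 0`. -/
def IsGeodesic (γ : ℝ → R3) : Prop :=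
  ContDiff ℝ ∞ γ ∧ ∀ t k, (deriv (deriv γ) t) k
    + ∑ i, ∑ j, g.christoffel k i j (γ t) * (deriv γ t) i * (deriv γ t) j = 0

/-- (Geodesic) completeness: through every point, in every direction, there is a geodesic that is
defined for all times. -/
def IsComplete : Prop :=
  ∀ p v : R3, ∃ γ : ℝ → R3, g.IsGeodesic γ ∧ γ 0 = p ∧ deriv γ 0 = v

/-- The vector `a^♯` metrically dual to a covector `a`, `(a^♯)^i = ∑_j g^{ij} a_j`. -/
def sharp (x : R3) (a : R3 →L[ℝ] ℝ) : R3 :=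
  ∑ i, (∑ j, (g.gram x)⁻¹ i j * a (coordVec j)) • coordVec i

/-- The scalar product `g(a, b) = ∑_{i,j} g^{ij} a_i b_j` of covectors. -/
def coinner (x : R3) (a b : R3 →L[ℝ] ℝ) : ℝ :=
  ∑ i, ∑ j, (g.gram x)⁻¹ i j * a (coordVec i) * b (coordVec j)

/-- The Riemannian volume form `± √(det g_{ij}) dx ∧ dy ∧ dz`, the sign being `+` exactly if `o` is
the orientation of the coordinates. -/
def vol (o : Orientation ℝ R3 (Fin 3)) (x : R3) (u v w : R3) : ℝ :=
  √(g.gram x).det * o.volumeForm ![u, v, w]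

/-- The Hodge star of a covector: the 2-form `∗a = vol (a^♯, ·, ·)`, so that
`b ∧ ∗a = g(b, a) vol`. -/
def hodgeStar (o : Orientation ℝ R3 (Fin 3)) (x : R3) (a : R3 →L[ℝ] ℝ) (u v : R3) : ℝ :=
  g.vol o x (g.sharp x a) u v

end RMetric

/-- The exterior derivative `dα` of a 1-form. -/
def d (α : R3 → R3 →L[ℝ] ℝ) (x u v : R3) : ℝ :=
  extDeriv (fun y => ContinuousAlternatingMap.ofSubsingleton ℝ R3 ℝ (0 : Fin 1) (α y)) x ![u, v]

/-- A contact form on `ℝ³`: a smooth 1-form with `α ∧ dα ≠ 0` at every point. -/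
def IsContactForm (α : R3 → R3 →L[ℝ] ℝ) : Prop :=
  ContDiff ℝ ∞ α ∧ ∀ x, ∃ u v w : R3,
    α x u * d α x v w + α x v * d α x w u + α x w * d α x u v ≠ 0

/-- `α` is a contact form for the plane field `ξ` (which is then a contact structure), and it
satisfies `dα = 2 lam ∗α`, `g(α, α) = 1` with the non-zero constant `lam`, for the metric `g` and
the orientation `o`. -/
structure IsAdaptedForm (g : RMetric) (o : Orientation ℝ R3 (Fin 3))
    (ξ : R3 → Submodule ℝ R3) (lam : ℝ) (α : R3 → R3 →L[ℝ] ℝ) : Prop where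
  contact : IsContactForm α
  ker_eq : ∀ x v, v ∈ ξ x ↔ α x v = 0
  lam_ne_zero : lam ≠ 0
  d_eq : ∀ x u v, d α x u v = 2 * lam * g.hodgeStar o x (α x) u v
  unit : ∀ x, g.coinner x (α x) (α x) = 1

/-- `φ^* g' = g` and `φ^* α' = α`. -/
def Pulls (φ : R3 → R3) (g : RMetric) (α : R3 → R3 →L[ℝ] ℝ)
    (g' : RMetric) (α' : R3 → R3 →L[ℝ] ℝ) : Prop :=
  (∀ x u v, g'.inner (φ x) (fderiv ℝ φ x u) (fderiv ℝ φ x v) = g.inner x u v) ∧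
    ∀ x u, α' (φ x) (fderiv ℝ φ x u) = α x u

/-- `(ℝ³, g, α)` and `(ℝ³, g', α')` are contact isometric. -/
def ContactIsometric (g : RMetric) (α : R3 → R3 →L[ℝ] ℝ)
    (g' : RMetric) (α' : R3 → R3 →L[ℝ] ℝ) : Prop :=
  ∃ φ : Diffeomorph 𝓘(ℝ, R3) 𝓘(ℝ, R3) R3 R3 ∞, Pulls φ g α g' α'

/-- There is a local diffeomorphism of the whole of `ℝ³` into `ℝ³` (not necessarily injective or
surjective) that is a contact isometry near every point. -/
def LocallyContactIsometric (g : RMetric) (α : R3 → R3 →L[ℝ] ℝ)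
    (g' : RMetric) (α' : R3 → R3 →L[ℝ] ℝ) : Prop :=
  ∃ φ : R3 → R3, IsLocalDiffeomorph 𝓘(ℝ, R3) 𝓘(ℝ, R3) ∞ φ ∧ Pulls φ g α g' α'

/-- The standard flat metric `dx² + dy² + dz²`. -/
def stdMetric : RMetric where
  inner _ := innerSL ℝ
  symm _ u v := real_inner_comm v u
  pos _ _ hv := real_inner_self_pos.2 hv
  smooth := contDiff_const

/-- The standard contact form `sin(2 lam z) dx + cos(2 lam z) dy`. -/
def stdForm (lam : ℝ) (p : R3) : R3 →L[ℝ] ℝ :=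
  Real.sin (2 * lam * p 2) • EuclideanSpace.proj (0 : Fin 3)
    + Real.cos (2 * lam * p 2) • EuclideanSpace.proj (1 : Fin 3)

end ContactR3

end

/-! A flat metric on `ℝ³` has a global developing map `F` with `F^* g₀ = g`. The equations for a
function with parallel differential form a linear total differential system whose integrability
condition is the symmetry of the Christoffel symbols together with the vanishing of the curvature.
Such a system is solved by transport along rays from the origin (`exists_hasFDerivAt_of_flat`,
`IsFlat.exists_isDeveloping`).

Seen through `F`, the form `α` becomes a unit field `b` with `curl b = μ b`, where `μ = 2 lam s` and
`s = ±1` is the sign of `det dF`. Let `A` be the derivative of `b` in the flat coframe. Unit length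
and the curl equation give `A b = 0`, and the divergence of the curl equation gives `tr A = 0`.
Differentiating `A b = 0` shows that the derivative of `A` along `b` is `-A²`, so `tr A² = 0` as
well. On the plane `b^⊥` this forces `A² = 0`, while the curl keeps `A` non-zero. Differentiating
`A² = 0` determines the second derivative (`second_deriv_eq`), and then `⟪A u, A v⟫` is constant.
Hence `A` sees a single fixed direction `N`, and `b` turns at constant speed along it
(`exists_eq_sin_cos`). A linear isometry after `F` brings this to the standard form.

If `g` is complete, `F` maps geodesics to lines defined for all times. Lifting the lines through `F
0` gives a continuous section of `F`, whose image is open and closed, so `F` is bijective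
(`bijective`). -/

open scoped InnerProductSpace

noncomputable section

namespace ContactR3

open Set Metric

/-! ### Linear ordinary differential equations on the unit interval -/

section LinearODE

variable {V : Type*} [NormedAddCommGroup V] [NormedSpace ℝ V] [CompleteSpace V]

/-- `w` is continuous on `[a, b]` and solves `w' = A w` there, in the sense of right derivatives. -/
def SolvesLinearODE (A : ℝ → V →L[ℝ] V) (a b : ℝ) (w : ℝ → V) : Prop :=
  ContinuousOn w (Icc a b) ∧ ∀ t ∈ Ico a b, HasDerivWithinAt w (A t (w t)) (Ici t) t

/-- Picard–Lindelöf on the ball of radius `‖w₀‖` about `w₀`, where the field is bounded by `2 K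
‖w₀‖`. By linearity the admissible step length does not depend on `w₀`, so steps of equal length can
be chained. -/
theorem exists_solvesLinearODE_short {A : ℝ → V →L[ℝ] V} (hA : Continuous A) {a τ K : ℝ}
    (hτ : 0 ≤ τ) (hK : ∀ t ∈ Icc a (a + τ), ‖A t‖ ≤ K) (hKτ : 2 * K * τ ≤ 1) (w₀ : V) :
    ∃ w, w a = w₀ ∧ SolvesLinearODE A a (a + τ) w := by
  have haa : a ∈ Icc a (a + τ) := ⟨le_rfl, by linarith⟩
  have hK0 : 0 ≤ K := (norm_nonneg _).trans (hK a haa)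
  lift K to NNReal using hK0
  have hf : IsPicardLindelof (fun t w ↦ A t w) (⟨a, haa⟩ : Icc a (a + τ)) w₀ ‖w₀‖₊ 0
      (2 * K * ‖w₀‖₊) K := by
    refine ⟨fun t ht ↦ ?_, fun x _ ↦ ?_, fun t ht x hx ↦ ?_, ?_⟩
    · exact ((A t).lipschitz.weaken (hK t ht)).lipschitzOnWith
    · exact (hA.clm_apply continuous_const).continuousOn
    · have hx' : ‖x‖ ≤ 2 * ‖w₀‖ := by
        have := norm_le_of_mem_closedBall hx
        simp at this
        linarith
      calc ‖A t x‖ ≤ ‖A t‖ * ‖x‖ := (A t).le_opNorm x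
        _ ≤ K * (2 * ‖w₀‖) := by gcongr; exact hK t ht
        _ = _ := by push_cast; ring
    · have : max (a + τ - a) (a - a) = τ := by simp [hτ]
      simp only [this]
      push_cast
      have := mul_le_mul_of_nonneg_right hKτ (norm_nonneg w₀)
      simp
      linarith
  obtain ⟨w, hw0, hw⟩ := hf.exists_eq_forall_mem_Icc_hasDerivWithinAt₀
  refine ⟨w, hw0, fun t ht ↦ (hw t ht).continuousWithinAt, fun t ht ↦ ?_⟩
  exact (hw t (Ico_subset_Icc_self ht)).mono_of_mem_nhdsWithin (Icc_mem_nhdsGE_of_mem ht)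

-- With right derivatives only, nothing but the values has to match at the junction.
omit [CompleteSpace V] in
theorem SolvesLinearODE.concat {A : ℝ → V →L[ℝ] V} {a b c : ℝ} {u w : ℝ → V} (hab : a ≤ b)
    (hbc : b ≤ c) (hu : SolvesLinearODE A a b u) (hw : SolvesLinearODE A b c w)
    (huw : u b = w b) :
    SolvesLinearODE A a c (fun t ↦ if t < b then u t else w t) := by
  constructor
  · have h1 : ContinuousOn (fun t ↦ if t < b then u t else w t) (Icc a b) :=
      hu.1.congr fun t ht ↦ by
        rcases ht.2.lt_or_eq with h | h
        · simp [h]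
        · simp [h, huw]
    have h2 : ContinuousOn (fun t ↦ if t < b then u t else w t) (Icc b c) :=
      hw.1.congr fun t ht ↦ by simp [not_lt.2 ht.1]
    rw [← Icc_union_Icc_eq_Icc hab hbc]
    exact h1.union_of_isClosed h2 isClosed_Icc isClosed_Icc
  · intro t ht
    rcases lt_or_ge t b with h | h
    · have := hu.2 t ⟨ht.1, h⟩
      simp only [h, if_true]
      refine this.congr_of_eventuallyEq ?_ (by simp [h])
      filter_upwards [mem_nhdsWithin_of_mem_nhds (Iio_mem_nhds h)] with s hs
      simp [mem_Iio.1 hs]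
    · have := hw.2 t ⟨h, ht.2⟩
      simp only [not_lt.2 h, if_false]
      exact this.congr (fun s hs ↦ by simp [h.trans hs]) (by simp [h])

theorem exists_solvesLinearODE {A : ℝ → V →L[ℝ] V} (hA : Continuous A) (w₀ : V) :
    ∃ w, w 0 = w₀ ∧ SolvesLinearODE A 0 1 w := by
  -- The interval `[0, 2]` contains every step `[n/N, n/N + 1/N]` by the crude bounds `n/N ≤ 1` and
  -- `1/N ≤ 1`.
  obtain ⟨K, hK⟩ := (isCompact_Icc (a := (0 : ℝ)) (b := 2)).exists_bound_of_continuousOn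
    hA.continuousOn
  obtain ⟨N, hN⟩ := exists_nat_ge (max (2 * K) 1)
  have hN1 : (1 : ℝ) ≤ N := (le_max_right _ _).trans hN
  have hN0 : (0 : ℝ) < N := by linarith
  have key : ∀ n : ℕ, n ≤ N → ∃ w, w 0 = w₀ ∧ SolvesLinearODE A 0 (n / N) w := by
    intro n
    induction n with
    | zero =>
      intro _
      exact ⟨fun _ ↦ w₀, rfl, continuousOn_const, fun t ht ↦ by simp at ht⟩
    | succ n ih =>
      intro hn
      obtain ⟨u, hu0, hu⟩ := ih (by omega)
      have hnN : (n : ℝ) / N ≤ 1 := by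
        rw [div_le_one hN0]; exact_mod_cast (by omega : n ≤ N)
      have hpos : (0 : ℝ) ≤ n / N := by positivity
      have hτ : (1 : ℝ) / N ≤ 1 := by rw [div_le_one hN0]; exact hN1
      obtain ⟨w, hw0, hw⟩ := exists_solvesLinearODE_short (a := n / N) (τ := 1 / N) (K := K) hA
        (by positivity)
        (fun t ht ↦ hK t ⟨by linarith [ht.1], by linarith [ht.2]⟩)
        (by rw [mul_one_div, div_le_one hN0]; exact (le_max_left _ _).trans hN) (u (n / N))
      have heq : ((n + 1 : ℕ) : ℝ) / N = n / N + 1 / N := by push_cast; ring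
      rw [heq]
      refine ⟨_, ?_, hu.concat hpos (by linarith [div_pos one_pos hN0]) hw hw0.symm⟩
      rcases hpos.lt_or_eq with h | h
      · simp [h, hu0]
      · rw [← h] at hw0 ⊢
        simp [hw0, hu0]
  simpa [hN0.ne'] using key N le_rfl

end LinearODE

/-! ### Flat total differential equations: existence and uniqueness -/

section Frobenius

variable {E V : Type*} [NormedAddCommGroup E] [NormedSpace ℝ E] [ProperSpace E]
  [NormedAddCommGroup V] [NormedSpace ℝ V]

/-- Second order Taylor estimate, uniform on bounded sets. -/
theorem exists_taylor_bound {W : Type*} [NormedAddCommGroup W] [NormedSpace ℝ W] {f : E → W}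
    (hf : ContDiff ℝ 2 f) (R : ℝ) :
    ∃ C, 0 ≤ C ∧ ∀ x ∈ closedBall (0 : E) R, ∀ y ∈ closedBall (0 : E) R,
      ‖f y - f x - fderiv ℝ f x (y - x)‖ ≤ C * ‖y - x‖ ^ 2 := by
  have h1 : ContDiff ℝ 1 (fderiv ℝ f) := hf.fderiv_right (by norm_num)
  obtain ⟨C, hC⟩ := h1.contDiffOn.exists_lipschitzOnWith (n := 1) (by norm_num)
    (convex_closedBall (0 : E) R) (isCompact_closedBall 0 R)
  refine ⟨C, C.2, fun x hx y hy ↦ ?_⟩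
  have hseg : segment ℝ x y ⊆ closedBall (0 : E) R := (convex_closedBall _ _).segment_subset hx hy
  have := (convex_segment x y).norm_image_sub_le_of_norm_hasFDerivWithin_le'
    (f := f) (f' := fderiv ℝ f) (φ := fderiv ℝ f x) (C := C * ‖y - x‖)
    (fun z _ ↦ ((hf.differentiable (by norm_num)) z).hasFDerivAt.hasFDerivWithinAt)
    (fun z hz ↦ by
      refine (hC.norm_sub_le (hseg hz) hx).trans ?_
      gcongr
      have := norm_sub_le_of_mem_segment hz
      simpa [norm_sub_rev] using this)
    (left_mem_segment ℝ x y) (right_mem_segment ℝ x y)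
  calc _ ≤ _ := this
    _ = _ := by ring

set_option maxSynthPendingDepth 3 in
/-- A solution along a segment of a flat total linear differential equation moves, to first order in
the segment, as the equation prescribes. -/
theorem exists_transport_bound {Ω : E → E →L[ℝ] V →L[ℝ] V} (hΩ : ContDiff ℝ 2 Ω)
    (hflat : ∀ x h k v, fderiv ℝ Ω x h k v + Ω x k (Ω x h v)
      = fderiv ℝ Ω x k h v + Ω x h (Ω x k v))
    (x : E) {w : ℝ → V} (hw : SolvesLinearODE (fun t ↦ Ω (t • x) x) 0 1 w) :
    ∃ D, ∀ h : E, ‖h‖ ≤ 1 → ∀ w' : ℝ → V, w' 0 = w 0 →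
      SolvesLinearODE (fun t ↦ Ω (t • (x + h)) (x + h)) 0 1 w' →
        ‖w' 1 - w 1 - Ω x h (w 1)‖ ≤ D * ‖h‖ ^ 2 := by
  set R := ‖x‖ + 1 with hR
  have hR0 : 0 < R := by positivity
  have hΩd : Differentiable ℝ Ω := hΩ.differentiable (by norm_num)
  obtain ⟨C, hC0, hC⟩ := exists_taylor_bound hΩ R
  obtain ⟨M, hM⟩ := (isCompact_closedBall (0 : E) R).exists_bound_of_continuousOn (f := Ω)
    hΩ.continuous.continuousOn
  obtain ⟨N, hN⟩ := (isCompact_closedBall (0 : E) R).exists_bound_of_continuousOn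
    (f := fun x ↦ ‖fderiv ℝ Ω x‖) (hΩ.continuous_fderiv (by norm_num)).norm.continuousOn
  simp only [norm_norm] at hN
  obtain ⟨B, hB⟩ := (isCompact_Icc (a := (0 : ℝ)) (b := 1)).exists_bound_of_continuousOn hw.1
  have h0mem : (0 : E) ∈ closedBall (0 : E) R := mem_closedBall_self hR0.le
  have hM0 : 0 ≤ M := (norm_nonneg _).trans (hM 0 h0mem)
  have hN0 : 0 ≤ N := (norm_nonneg _).trans (hN 0 h0mem)
  have hB0 : 0 ≤ B := (norm_nonneg _).trans (hB 0 (by simp))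
  set S := C * R + N with hS
  have hS0 : 0 ≤ S := by positivity
  set D₀ := S * B + (S + M + N * R) * (M * B) with hD₀
  -- The summand `1` makes `K` non-zero, as the closed form of the Grönwall bound requires.
  set K : NNReal := ⟨M * R + 1, by positivity⟩ with hK
  refine ⟨D₀ / K * (Real.exp (K * 1) - 1), fun h hh w' hw0 hw' ↦ ?_⟩
  have hyR : ‖x + h‖ ≤ R := (norm_add_le _ _).trans (by linarith)
  have hmem : ∀ z : E, ‖z‖ ≤ R → ∀ t ∈ Icc (0 : ℝ) 1, t • z ∈ closedBall (0 : E) R := by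
    intro z hz t ht
    rw [mem_closedBall_zero_iff, norm_smul, Real.norm_of_nonneg ht.1]
    nlinarith [ht.2, norm_nonneg z, ht.1]
  have hxR : ‖x‖ ≤ R := by linarith
  -- The first order guess for the solution along the ray to `x + h`. Flatness makes it solve that
  -- equation up to an error of order `‖h‖ ^ 2`, and Grönwall's inequality compares it with `w'`.
  set z : ℝ → V := fun t ↦ w t + t • Ω (t • x) h (w t) with hz
  set z' : ℝ → V := fun t ↦ Ω (t • x) x (w t) + (Ω (t • x) h (w t) +
    t • (fderiv ℝ Ω (t • x) x h (w t) + Ω (t • x) h (Ω (t • x) x (w t)))) with hz'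
  have hzc : ContinuousOn z (Icc 0 1) := by
    have : Continuous fun t : ℝ ↦ Ω (t • x) h := by fun_prop
    exact hw.1.add (continuousOn_id.smul (this.continuousOn.clm_apply hw.1))
  have hzd : ∀ t ∈ Ico (0 : ℝ) 1, HasDerivWithinAt z (z' t) (Ici t) t := by
    intro t ht
    have hwt := hw.2 t ht
    have h1 : HasDerivAt (fun s : ℝ ↦ s • x) x t := by
      simpa using (hasDerivAt_id t).smul_const x
    have h2 : HasDerivAt (fun s : ℝ ↦ Ω (s • x)) (fderiv ℝ Ω (t • x) x) t :=
      (hΩd (t • x)).hasFDerivAt.comp_hasDerivAt t h1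
    have h3 : HasDerivAt (fun s : ℝ ↦ Ω (s • x) h) (fderiv ℝ Ω (t • x) x h) t := by
      simpa using h2.clm_apply (hasDerivAt_const t h)
    have h4 := h3.hasDerivWithinAt.clm_apply hwt
    have h5 := (hasDerivAt_id t).hasDerivWithinAt.smul h4
    refine (hwt.add h5).congr_deriv ?_
    simp only [hz', id]
    module
  have hres : ∀ t ∈ Ico (0 : ℝ) 1,
      dist (z' t) (Ω (t • (x + h)) (x + h) (z t)) ≤ D₀ * ‖h‖ ^ 2 := by
    intro t ht
    have htI : t ∈ Icc (0 : ℝ) 1 := Ico_subset_Icc_self ht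
    -- `Q` is the Taylor remainder of `Ω`, `P` the second order part of the change of the
    -- coefficient, and `P'` the whole change, which is of first order.
    set Q := Ω (t • (x + h)) - Ω (t • x) - fderiv ℝ Ω (t • x) (t • (x + h) - t • x) with hQ
    set P := Q (x + h) + t • fderiv ℝ Ω (t • x) h h with hP
    set P' := P + (Ω (t • x) h + t • fderiv ℝ Ω (t • x) h x) with hP'
    have hΩy : Ω (t • (x + h)) (x + h) = Ω (t • x) x + P' := by
      simp only [hP', hP, hQ, smul_add, add_sub_cancel_left, map_add, map_smul,
        sub_apply, smul_apply]
      module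
    have hid : z' t - Ω (t • (x + h)) (x + h) (z t)
        = -(P (w t)) - t • P' (Ω (t • x) h (w t)) := by
      simp only [hz', hz, hΩy]
      -- Flatness exchanges `x` and `h`, after which all terms of first order in `h` cancel.
      rw [hflat (t • x) x h (w t)]
      simp only [hP', add_apply, map_add, map_smul,
        smul_apply]
      module
    have ht1 : ‖t‖ ≤ 1 := by rw [Real.norm_of_nonneg ht.1]; exact ht.2.le
    have hNt := hN _ (hmem x hxR t htI)
    have hMt := hM _ (hmem x hxR t htI)
    have hBt := hB t htI
    have hQb : ‖Q‖ ≤ C * ‖h‖ ^ 2 := by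
      refine (hC _ (hmem x hxR t htI) _ (hmem _ hyR t htI)).trans ?_
      have : t • (x + h) - t • x = t • h := by module
      rw [this, norm_smul]
      gcongr
      exact mul_le_of_le_one_left (norm_nonneg h) ht1
    have hDh : ∀ k, ‖fderiv ℝ Ω (t • x) h k‖ ≤ N * ‖h‖ * ‖k‖ := fun k ↦
      ((fderiv ℝ Ω (t • x) h).le_opNorm k).trans
        (by gcongr; exact ((fderiv ℝ Ω (t • x)).le_opNorm h).trans (by gcongr))
    have hPb : ‖P‖ ≤ S * ‖h‖ ^ 2 := by
      calc ‖P‖ ≤ ‖Q (x + h)‖ + ‖t • fderiv ℝ Ω (t • x) h h‖ := norm_add_le _ _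
        _ ≤ (C * ‖h‖ ^ 2) * R + 1 * (N * ‖h‖ * ‖h‖) := by
          gcongr
          · exact (Q.le_opNorm _).trans (by gcongr)
          · rw [norm_smul]; gcongr; exact hDh h
        _ = S * ‖h‖ ^ 2 := by rw [hS]; ring
    have hΩh : ‖Ω (t • x) h‖ ≤ M * ‖h‖ := ((Ω (t • x)).le_opNorm h).trans (by gcongr)
    have hP'b : ‖P'‖ ≤ (S + M + N * R) * ‖h‖ := by
      calc ‖P'‖ ≤ ‖P‖ + (‖Ω (t • x) h‖ + ‖t • fderiv ℝ Ω (t • x) h x‖) :=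
            (norm_add_le _ _).trans (by gcongr; exact norm_add_le _ _)
        _ ≤ S * ‖h‖ + (M * ‖h‖ + 1 * (N * ‖h‖ * R)) := by
          gcongr
          · refine hPb.trans ?_
            gcongr
            nlinarith [norm_nonneg h]
          · rw [norm_smul]; gcongr; exact (hDh x).trans (by gcongr)
        _ = _ := by ring
    rw [dist_eq_norm, hid]
    calc _ ≤ ‖P (w t)‖ + ‖t • P' (Ω (t • x) h (w t))‖ := by
          refine (norm_sub_le _ _).trans ?_
          rw [norm_neg]
      _ ≤ (S * ‖h‖ ^ 2) * B + 1 * (((S + M + N * R) * ‖h‖) * (M * ‖h‖ * B)) := by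
          gcongr
          · exact (P.le_opNorm _).trans (by gcongr)
          · rw [norm_smul]
            gcongr
            refine (P'.le_opNorm _).trans ?_
            gcongr
            exact ((Ω (t • x) h).le_opNorm _).trans (by gcongr)
      _ = D₀ * ‖h‖ ^ 2 := by rw [hD₀]; ring
  have hlip : ∀ t ∈ Ico (0 : ℝ) 1,
      LipschitzOnWith K (fun v ↦ Ω (t • (x + h)) (x + h) v) univ := by
    intro t ht
    refine ((Ω (t • (x + h)) (x + h)).lipschitz.weaken ?_).lipschitzOnWith
    change ‖Ω (t • (x + h)) (x + h)‖ ≤ M * R + 1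
    refine ((Ω (t • (x + h))).le_opNorm _).trans ?_
    have := hM _ (hmem _ hyR t (Ico_subset_Icc_self ht))
    nlinarith [mul_le_mul this hyR (norm_nonneg _) hM0]
  have := dist_le_of_approx_trajectories_ODE_of_mem (δ := 0) (εf := 0) hlip hw'.1 hw'.2
    (fun t _ ↦ (dist_self _).le) (fun _ _ ↦ mem_univ _) hzc hzd hres (fun _ _ ↦ mem_univ _)
    (by simp [hz, hw0]) 1 (by simp)
  have hK0 : (K : ℝ) ≠ 0 := by
    have : (0 : ℝ) < M * R + 1 := by positivity
    exact this.ne'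
  rw [gronwallBound_of_K_ne_0 hK0, dist_eq_norm] at this
  simp only [hz, one_smul] at this
  calc _ = ‖w' 1 - (w 1 + Ω x h (w 1))‖ := by congr 1; abel
    _ ≤ _ := this
    _ = _ := by rw [sub_zero]; ring

/-- **Frobenius theorem** for total linear differential equations: a flat equation `Du = Ω u` on the
whole space has a solution with any given value at the origin. -/
theorem exists_hasFDerivAt_of_flat [CompleteSpace V] {Ω : E → E →L[ℝ] V →L[ℝ] V}
    (hΩ : ContDiff ℝ 2 Ω)
    (hflat : ∀ x h k v, fderiv ℝ Ω x h k v + Ω x k (Ω x h v)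
      = fderiv ℝ Ω x k h v + Ω x h (Ω x k v)) (u₀ : V) :
    ∃ u : E → V, u 0 = u₀ ∧ ∀ x, HasFDerivAt u ((Ω x).flip (u x)) x := by
  have hex : ∀ y : E, ∃ w : ℝ → V, w 0 = u₀ ∧ SolvesLinearODE (fun t ↦ Ω (t • y) y) 0 1 w :=
    fun y ↦ exists_solvesLinearODE (by have := hΩ.continuous; fun_prop) u₀
  choose w hw0 hw using hex
  have hder : ∀ x, HasFDerivAt (fun y ↦ w y 1) ((Ω x).flip (w x 1)) x := by
    intro x
    obtain ⟨D, hD⟩ := exists_transport_bound hΩ hflat x (hw x)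
    rw [hasFDerivAt_iff_isLittleO_nhds_zero]
    refine Asymptotics.IsBigO.trans_isLittleO (g := fun h : E ↦ ‖h‖ ^ 2) ?_
      (Asymptotics.isLittleO_norm_pow_id one_lt_two)
    refine Asymptotics.IsBigO.of_bound D ?_
    filter_upwards [closedBall_mem_nhds (0 : E) one_pos] with h hh
    have := hD h (by simpa using hh) (w (x + h)) (by rw [hw0, hw0]) (hw (x + h))
    simpa using this
  refine ⟨fun y ↦ w y 1, ?_, hder⟩
  -- On the ray to the origin the coefficient is `Ω 0 0 = 0`, so the solution stays at `u₀`.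
  have hc := eq_zero_of_abs_deriv_le_mul_abs_self_of_eq_zero_right (K := 0) (a := 0) (b := 1)
    (f := fun t ↦ w 0 t - u₀) ((hw 0).1.sub continuousOn_const)
    (fun t ht ↦ ((hw 0).2 t ht).sub_const u₀) (by simp [hw0]) (by simp) 1 (by simp)
  exact sub_eq_zero.1 hc

omit [ProperSpace E] in
/-- A solution of `Du = Ω u` that vanishes at the origin vanishes identically. -/
theorem eq_zero_of_hasFDerivAt {Ω : E → E →L[ℝ] V →L[ℝ] V} (hΩ : Continuous Ω) {u : E → V}
    (hu : ∀ x, HasFDerivAt u ((Ω x).flip (u x)) x) (h0 : u 0 = 0) (x : E) : u x = 0 := by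
  have hA : Continuous fun t : ℝ ↦ Ω (t • x) x := by fun_prop
  obtain ⟨K, hK⟩ := (isCompact_Icc (a := (0 : ℝ)) (b := 1)).exists_bound_of_continuousOn
    hA.continuousOn
  have hd : ∀ t : ℝ, HasDerivAt (fun s : ℝ ↦ u (s • x)) (Ω (t • x) x (u (t • x))) t := by
    intro t
    have h1 : HasDerivAt (fun s : ℝ ↦ s • x) x t := by
      simpa using (hasDerivAt_id t).smul_const x
    exact (hu (t • x)).comp_hasDerivAt t h1
  have := eq_zero_of_abs_deriv_le_mul_abs_self_of_eq_zero_right (K := K) (a := 0) (b := 1)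
    (f := fun t : ℝ ↦ u (t • x)) (fun t _ ↦ (hd t).continuousAt.continuousWithinAt)
    (fun t _ ↦ (hd t).hasDerivWithinAt) (by simp [h0])
    (fun t ht ↦ ((Ω (t • x) x).le_opNorm _).trans
      (by gcongr; exact hK t (Ico_subset_Icc_self ht))) 1 (by simp)
  simpa using this

end Frobenius

/-! ### Total differential systems in coordinates -/

section Coordinates

variable {ι : Type*} [Fintype ι] [DecidableEq ι]

/-- The elementary `End(ℝ^ι)`-valued 1-form `dxᵢ ⊗ E_{pq}`. -/
def elemForm (i : Fin 3) (p q : ι) : R3 →L[ℝ] (ι → ℝ) →L[ℝ] (ι → ℝ) :=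
  (EuclideanSpace.proj i : R3 →L[ℝ] ℝ).smulRight
    ((ContinuousLinearMap.proj q : (ι → ℝ) →L[ℝ] ℝ).smulRight (Pi.single p (1 : ℝ)))

/-- The matrix valued 1-form `∑ᵢ cᵢ dxᵢ`. -/
def matrixForm (c : Fin 3 → ι → ι → R3 → ℝ) (x : R3) : R3 →L[ℝ] (ι → ℝ) →L[ℝ] (ι → ℝ) :=
  ∑ i, ∑ p, ∑ q, c i p q x • elemForm i p q

omit [Fintype ι] in
theorem elemForm_apply (i : Fin 3) (p q r : ι) (h : R3) (v : ι → ℝ) :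
    elemForm i p q h v r = if r = p then h i * v q else 0 := by
  simp [elemForm, Pi.single_apply]

theorem matrixForm_apply (c : Fin 3 → ι → ι → R3 → ℝ) (x h : R3) (v : ι → ℝ) (p : ι) :
    matrixForm c x h v p = ∑ i, ∑ q, c i p q x * (h i * v q) := by
  simp only [matrixForm, sum_apply, Finset.sum_apply, smul_apply, Pi.smul_apply,
    elemForm_apply, smul_eq_mul, mul_ite, mul_zero]
  refine Finset.sum_congr rfl fun i _ ↦ ?_
  rw [Finset.sum_comm]
  refine Finset.sum_congr rfl fun q _ ↦ ?_
  simp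

set_option maxSynthPendingDepth 3 in
theorem contDiff_matrixForm {n : WithTop ℕ∞} {c : Fin 3 → ι → ι → R3 → ℝ}
    (hc : ∀ i p q, ContDiff ℝ n (c i p q)) : ContDiff ℝ n (matrixForm c) := by
  unfold matrixForm
  exact ContDiff.sum fun i _ ↦ ContDiff.sum fun p _ ↦ ContDiff.sum fun q _ ↦
    (hc i p q).smul contDiff_const

theorem coordVec_apply (i j : Fin 3) : coordVec i j = if j = i then 1 else 0 := by
  simp [coordVec]

theorem apply_eq_sum_coordVec (L : R3 →L[ℝ] ℝ) (h : R3) : L h = ∑ i, h i * L (coordVec i) := by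
  have : h = ∑ i, h i • coordVec i := by
    ext j
    simp [coordVec_apply]
  conv_lhs => rw [this]
  simp

theorem fderiv_matrixForm_apply {c : Fin 3 → ι → ι → R3 → ℝ}
    (hc : ∀ i p q, ContDiff ℝ ∞ (c i p q)) (x h k : R3) (v : ι → ℝ) (p : ι) :
    fderiv ℝ (matrixForm c) x h k v p
      = ∑ i, ∑ q, (∑ j, h j * fderiv ℝ (c i p q) x (coordVec j)) * (k i * v q) := by
  have h1 : HasFDerivAt (matrixForm c) (fderiv ℝ (matrixForm c) x) x :=
    ((contDiff_matrixForm hc).differentiable (by simp) x).hasFDerivAt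
  have h2 := (hasFDerivAt_pi'.1
    ((h1.clm_apply (hasFDerivAt_const k x)).clm_apply (hasFDerivAt_const v x))) p
  have h3 : HasFDerivAt (fun y ↦ matrixForm c y k v p)
      (∑ i, ∑ q, (fderiv ℝ (c i p q) x).smulRight (k i * v q)) x := by
    simp only [matrixForm_apply]
    refine HasFDerivAt.fun_sum fun i _ ↦ HasFDerivAt.fun_sum fun q _ ↦ ?_
    exact ((hc i p q).differentiable (by simp) x).hasFDerivAt.smul_const (k i * v q)
  have := congrArg (fun L ↦ L h) (h2.unique h3)
  simp only [← apply_eq_sum_coordVec]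
  simpa [sum_apply] using this

omit [DecidableEq ι] in
theorem sum_derivative_swap (D : Fin 3 → Fin 3 → ι → ℝ) (h k : Fin 3 → ℝ) (v : ι → ℝ) :
    ∑ i, ∑ r, (∑ j, h j * D j i r) * (k i * v r)
      = ∑ i, ∑ j, ∑ r, h i * k j * v r * D i j r := by
  have : ∀ i, ∑ r, (∑ j, h j * D j i r) * (k i * v r)
      = ∑ j, ∑ r, h j * k i * v r * D j i r := fun i ↦ by
    simp only [Finset.sum_mul]
    rw [Finset.sum_comm]
    exact Finset.sum_congr rfl fun j _ ↦ Finset.sum_congr rfl fun r _ ↦ by ring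
  simp only [this]
  exact Finset.sum_comm

omit [DecidableEq ι] in
theorem sum_product_swap (C : Fin 3 → ι → ℝ) (D : Fin 3 → ι → ι → ℝ) (h k : Fin 3 → ℝ)
    (v : ι → ℝ) :
    ∑ i, ∑ q, C i q * (k i * ∑ j, ∑ r, D j q r * (h j * v r))
      = ∑ i, ∑ j, ∑ r, h i * k j * v r * ∑ q, C j q * D i q r := by
  have : ∀ i, ∑ q, C i q * (k i * ∑ j, ∑ r, D j q r * (h j * v r))
      = ∑ j, ∑ r, h j * k i * v r * ∑ q, C i q * D j q r := fun i ↦ by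
    simp only [Finset.mul_sum]
    rw [Finset.sum_comm]
    refine Finset.sum_congr rfl fun j _ ↦ ?_
    rw [Finset.sum_comm]
    exact Finset.sum_congr rfl fun r _ ↦ Finset.sum_congr rfl fun q _ ↦ by ring
  simp only [this]
  exact Finset.sum_comm

/-- Frobenius theorem in coordinates: a flat total linear system `∂ᵢ u = cᵢ u` has a solution with
any given value at the origin. -/
theorem exists_system_solution {c : Fin 3 → ι → ι → R3 → ℝ}
    (hc : ∀ i p q, ContDiff ℝ ∞ (c i p q))
    (hflat : ∀ i j p r x, fderiv ℝ (c j p r) x (coordVec i) - fderiv ℝ (c i p r) x (coordVec j)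
      + ∑ q, (c j p q x * c i q r x - c i p q x * c j q r x) = 0) (u₀ : ι → ℝ) :
    ∃ u : R3 → ι → ℝ, u 0 = u₀ ∧ ContDiff ℝ ∞ u ∧
      ∀ x, HasFDerivAt u ((matrixForm c x).flip (u x)) x := by
  have hsm : ContDiff ℝ ∞ (matrixForm c) := contDiff_matrixForm hc
  obtain ⟨u, hu0, hu⟩ := exists_hasFDerivAt_of_flat (Ω := matrixForm c)
    (by exact_mod_cast contDiff_infty.1 hsm 2) (fun x h k v ↦ by
      ext p
      have key : ∑ i, ∑ j, ∑ r, h i * k j * v r * (fderiv ℝ (c j p r) x (coordVec i)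
          - fderiv ℝ (c i p r) x (coordVec j)
          + ∑ q, (c j p q x * c i q r x - c i p q x * c j q r x)) = 0 :=
        Finset.sum_eq_zero fun i _ ↦ Finset.sum_eq_zero fun j _ ↦ Finset.sum_eq_zero fun r _ ↦ by
          rw [hflat, mul_zero]
      simp only [mul_add, mul_sub, Finset.sum_add_distrib, Finset.sum_sub_distrib] at key
      simp only [Pi.add_apply, fderiv_matrixForm_apply hc, matrixForm_apply]
      rw [sum_derivative_swap (fun j i r ↦ fderiv ℝ (c i p r) x (coordVec j)),
        sum_derivative_swap (fun j i r ↦ fderiv ℝ (c i p r) x (coordVec j)) (fun i ↦ k i)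
          (fun i ↦ h i),
        sum_product_swap (fun i q ↦ c i p q x) (fun i q r ↦ c i q r x),
        sum_product_swap (fun i q ↦ c i p q x) (fun i q r ↦ c i q r x) (fun i ↦ k i)
          (fun i ↦ h i)]
      have e1 := Finset.sum_comm (s := Finset.univ) (t := Finset.univ)
        (f := fun i j ↦ ∑ r, k i * h j * v r * fderiv ℝ (c j p r) x (coordVec i))
      have e2 := Finset.sum_comm (s := Finset.univ) (t := Finset.univ)
        (f := fun i j ↦ ∑ r, k i * h j * v r * ∑ q, c j p q x * c i q r x)
      rw [e1, e2]
      simp only [mul_comm (k _) (h _)]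
      linarith) u₀
  refine ⟨u, hu0, ?_, hu⟩
  -- Bootstrap: the derivative of `u` is a smooth expression in `x`, linear in `u`, so it is as
  -- regular as `u`.
  rw [contDiff_infty]
  intro n
  induction n with
  | zero => exact contDiff_zero.2 (continuous_iff_continuousAt.2 fun x ↦ (hu x).continuousAt)
  | succ n ih =>
    push_cast
    rw [contDiff_succ_iff_fderiv]
    refine ⟨fun x ↦ (hu x).differentiableAt, by simp, ?_⟩
    have : fderiv ℝ u = fun x ↦ (matrixForm c x).flip (u x) := funext fun x ↦ (hu x).fderiv
    rw [this]
    refine contDiff_clm_apply_iff.2 fun h ↦ ?_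
    exact ((contDiff_infty.1 hsm n).clm_apply contDiff_const).clm_apply ih

end Coordinates

/-! ### The Levi-Civita connection in coordinates -/

namespace RMetric

variable (g : RMetric)

theorem inner_eq_sum (x u v : R3) : g.inner x u v = ∑ i, ∑ j, u i * v j * g.gram x i j := by
  have h : ∀ j, g.inner x u (coordVec j) = ∑ i, u i * g.inner x (coordVec i) (coordVec j) :=
    fun j ↦ by simpa using apply_eq_sum_coordVec ((g.inner x).flip (coordVec j)) u
  rw [apply_eq_sum_coordVec]
  simp only [h, Finset.mul_sum]
  rw [Finset.sum_comm]
  refine Finset.sum_congr rfl fun i _ ↦ Finset.sum_congr rfl fun j _ ↦ ?_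
  rw [gram, Matrix.of_apply]
  ring

theorem gram_symm (x : R3) (i j : Fin 3) : g.gram x i j = g.gram x j i := g.symm _ _ _

theorem gram_posDef (x : R3) : (g.gram x).PosDef := by
  refine Matrix.PosDef.of_dotProduct_mulVec_pos ?_ fun v hv ↦ ?_
  · ext i j
    simpa using g.gram_symm x j i
  · have h := g.pos x (WithLp.toLp 2 v) (by simpa using hv)
    rw [inner_eq_sum] at h
    refine h.trans_eq ?_
    simp only [dotProduct, Matrix.mulVec, Finset.mul_sum, star_trivial]
    refine Finset.sum_congr rfl fun i _ ↦ Finset.sum_congr rfl fun j _ ↦ by ring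

theorem gram_det_pos (x : R3) : 0 < (g.gram x).det := (g.gram_posDef x).det_pos

theorem contDiff_gram (i j : Fin 3) : ContDiff ℝ ∞ fun x ↦ g.gram x i j :=
  (g.smooth.clm_apply contDiff_const).clm_apply contDiff_const

/-- Cramer's rule: the adjugate divided by a positive determinant. -/
theorem contDiff_gram_inv (i j : Fin 3) : ContDiff ℝ ∞ fun x ↦ (g.gram x)⁻¹ i j := by
  have hd : ContDiff ℝ ∞ fun x ↦ (g.gram x).det := by
    simp only [Matrix.det_apply']
    exact ContDiff.sum fun σ _ ↦ contDiff_const.mul (contDiff_prod fun i _ ↦ g.contDiff_gram _ _)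
  have ha : ContDiff ℝ ∞ fun x ↦ (g.gram x).adjugate i j := by
    simp only [Matrix.adjugate_apply, Matrix.det_apply']
    refine ContDiff.sum fun σ _ ↦ contDiff_const.mul (contDiff_prod fun k _ ↦ ?_)
    simp only [Matrix.updateRow_apply]
    split_ifs
    · exact contDiff_const
    · exact g.contDiff_gram _ _
  simp only [Matrix.inv_def, Matrix.smul_apply, Ring.inverse_eq_inv', smul_eq_mul]
  exact (hd.inv fun x ↦ (g.gram_det_pos x).ne').mul ha

theorem contDiff_dGram (l i j : Fin 3) : ContDiff ℝ ∞ (g.dGram l i j) :=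
  ((g.contDiff_gram i j).fderiv_right (m := ∞) (by simp)).clm_apply contDiff_const

theorem contDiff_christoffel (k i j : Fin 3) : ContDiff ℝ ∞ (g.christoffel k i j) :=
  contDiff_const.mul (ContDiff.sum fun l _ ↦ (g.contDiff_gram_inv k l).mul
    (((g.contDiff_dGram i j l).add (g.contDiff_dGram j i l)).sub (g.contDiff_dGram l i j)))

theorem dGram_symm (l i j : Fin 3) : g.dGram l i j = g.dGram l j i := by
  ext x
  simp only [dGram, g.gram_symm _ i j]

theorem christoffel_symm (k i j : Fin 3) : g.christoffel k i j = g.christoffel k j i := by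
  ext x
  simp only [christoffel, g.dGram_symm _ i j]
  congr 1
  refine Finset.sum_congr rfl fun l _ ↦ by ring

theorem sum_gram_christoffel (x : R3) (i j k : Fin 3) :
    ∑ m, g.gram x k m * g.christoffel m i j x
      = (1 / 2 : ℝ) * (g.dGram i j k x + g.dGram j i k x - g.dGram k i j x) := by
  have h : g.gram x * (g.gram x)⁻¹ = 1 :=
    Matrix.mul_nonsing_inv _ (g.gram_det_pos x).ne'.isUnit
  set T : Fin 3 → ℝ := fun l ↦ g.dGram i j l x + g.dGram j i l x - g.dGram l i j x with hT
  have h2 : (g.gram x).mulVec ((g.gram x)⁻¹.mulVec T) k = T k := by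
    rw [Matrix.mulVec_mulVec, h, Matrix.one_mulVec]
  change _ = 1 / 2 * T k
  rw [← h2]
  simp only [christoffel, Matrix.mulVec, dotProduct, Finset.mul_sum]
  exact Finset.sum_congr rfl fun m _ ↦ Finset.sum_congr rfl fun l _ ↦ by ring

/-- The Levi-Civita connection is compatible with the metric. -/
theorem dGram_eq (x : R3) (l i j : Fin 3) :
    g.dGram l i j x = ∑ m, (g.christoffel m l i x * g.gram x m j
      + g.christoffel m l j x * g.gram x i m) := by
  have h1 := g.sum_gram_christoffel x l i j
  have h2 := g.sum_gram_christoffel x l j i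
  simp only [g.gram_symm x j] at h1
  rw [Finset.sum_add_distrib]
  simp only [mul_comm (g.christoffel _ _ _ x)]
  rw [h1, h2, g.dGram_symm l j i, g.dGram_symm j l i, g.dGram_symm i l j]
  ring

end RMetric

/-! ### Parallel differentials and the developing map -/

namespace RMetric

variable (g : RMetric)

/-- The coefficients of the system `∂ᵢ f = θᵢ`, `∂ᵢ θₖ = ∑ₗ Γˡᵢₖ θₗ` for a function `f` with
parallel differential `θ`. -/
def parallelCoeff (i : Fin 3) : Option (Fin 3) → Option (Fin 3) → R3 → ℝ
  | none, none, _ => 0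
  | none, some k, _ => if k = i then 1 else 0
  | some _, none, _ => 0
  | some k, some l, x => g.christoffel l i k x

variable {g}

/-- The index `none` carries `f` and the indices `some k` carry `θₖ`. Integrability of the equations
for `f` is the symmetry of `Γ`; for those of `θ` it is the vanishing of the curvature. -/
theorem IsFlat.exists_parallel (hg : g.IsFlat) (θ₀ : Fin 3 → ℝ) :
    ∃ (f : R3 → ℝ) (θ : Fin 3 → R3 → ℝ), ContDiff ℝ ∞ f ∧ (∀ k, θ k 0 = θ₀ k) ∧
      (∀ x h, fderiv ℝ f x h = ∑ k, h k * θ k x) ∧ (∀ k, ContDiff ℝ ∞ (θ k)) ∧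
      ∀ k x h, fderiv ℝ (θ k) x h = ∑ i, ∑ l, h i * (g.christoffel l i k x * θ l x) := by
  have hconst : ∀ i o (x : R3), fderiv ℝ (g.parallelCoeff i none o) x = 0 := fun i o x ↦ by
    cases o with
    | none => exact fderiv_const_apply 0
    | some k => exact fderiv_const_apply (if k = i then 1 else 0)
  have hconst' : ∀ i k (x : R3), fderiv ℝ (g.parallelCoeff i (some k) none) x = 0 :=
    fun i k x ↦ fderiv_const_apply 0
  have hΓ : ∀ i k l, g.parallelCoeff i (some k) (some l) = g.christoffel l i k :=
    fun _ _ _ ↦ rfl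
  obtain ⟨u, hu0, hus, hu⟩ := exists_system_solution (c := g.parallelCoeff)
    (fun i p q ↦ by
      rcases p with _ | p <;> rcases q with _ | q
      exacts [contDiff_const, contDiff_const, contDiff_const, g.contDiff_christoffel _ _ _])
    (fun i j p r x ↦ by
      rcases p with _ | p <;> rcases r with _ | r
      · simp [parallelCoeff, Fintype.sum_option, hconst]
      · simp [parallelCoeff, Fintype.sum_option, g.christoffel_symm r i j, hconst]
      · simp [parallelCoeff, Fintype.sum_option, hconst']
      · have := hg r p i j x
        simp only [riemann] at this
        simp only [Fintype.sum_option, hΓ]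
        rw [← this]
        simp only [parallelCoeff, zero_mul, sub_zero, zero_add]
        congr 1
        refine Finset.sum_congr rfl fun m _ ↦ by ring)
    (fun o ↦ o.elim 0 θ₀)
  have hus' := contDiff_pi.1 hus
  have hd : ∀ p x h, fderiv ℝ (fun y ↦ u y p) x h = matrixForm g.parallelCoeff x h (u x) p :=
    fun p x h ↦ by rw [(hasFDerivAt_pi'.1 (hu x) p).fderiv]; simp
  refine ⟨fun x ↦ u x none, fun k x ↦ u x (some k), hus' _, fun k ↦ by simp [hu0],
    fun x h ↦ ?_, fun k ↦ hus' _, fun k x h ↦ ?_⟩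
  · rw [hd, matrixForm_apply]
    simp [parallelCoeff, Fintype.sum_option]
  · rw [hd, matrixForm_apply]
    simp only [parallelCoeff, Fintype.sum_option]
    refine Finset.sum_congr rfl fun i _ ↦ ?_
    rw [zero_mul, zero_add]
    exact Finset.sum_congr rfl fun l _ ↦ by ring

/-- The coefficients of the linear system `∇ h = 0` for a bilinear form `h`. -/
def parallelFormCoeff (g : RMetric) (l : Fin 3) (p q : Fin 3 × Fin 3) (x : R3) : ℝ :=
  (if q.2 = p.2 then g.christoffel q.1 l p.1 x else 0)
    + (if q.1 = p.1 then g.christoffel q.2 l p.2 x else 0)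

/-- A parallel bilinear form that agrees with the metric at the origin is the metric. -/
theorem eq_gram_of_parallel {h : Fin 3 → Fin 3 → R3 → ℝ} (hd : ∀ i j, Differentiable ℝ (h i j))
    (hp : ∀ i j x v, fderiv ℝ (h i j) x v = ∑ l, v l * ∑ m, (g.christoffel m l i x * h m j x
      + g.christoffel m l j x * h i m x))
    (h0 : ∀ i j, h i j 0 = g.gram 0 i j) (i j : Fin 3) (x : R3) : h i j x = g.gram x i j := by
  have hgd : ∀ i j, Differentiable ℝ fun y ↦ g.gram y i j :=
    fun i j ↦ (g.contDiff_gram i j).differentiable (by simp)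
  -- By metric compatibility `g` solves the same linear system as `h`, so the difference is a
  -- solution with value zero at the origin.
  have key := eq_zero_of_hasFDerivAt (Ω := matrixForm g.parallelFormCoeff)
    (contDiff_matrixForm (n := ∞) fun l p q ↦ by
      unfold parallelFormCoeff
      refine ContDiff.add ?_ ?_ <;> split_ifs <;>
        first | exact contDiff_const | exact g.contDiff_christoffel _ _ _).continuous
    (u := fun y p ↦ h p.1 p.2 y - g.gram y p.1 p.2) (fun y ↦ by
      rw [hasFDerivAt_pi']
      intro p
      have := ((hd p.1 p.2 y).sub (hgd p.1 p.2 y)).hasFDerivAt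
      refine this.congr_fderiv ?_
      ext v
      have e : fderiv ℝ (fun y ↦ g.gram y p.1 p.2) y v = ∑ l, v l * g.dGram l p.1 p.2 y :=
        apply_eq_sum_coordVec _ v
      change fderiv ℝ ((h p.1 p.2) - fun y ↦ g.gram y p.1 p.2) y v
        = matrixForm g.parallelFormCoeff y v _ p
      rw [fderiv_sub (hd _ _ y) (hgd _ _ y), sub_apply, hp, e, matrixForm_apply,
        ← Finset.sum_sub_distrib]
      refine Finset.sum_congr rfl fun l _ ↦ ?_
      rw [g.dGram_eq, ← mul_sub, ← Finset.sum_sub_distrib, Fintype.sum_prod_type]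
      simp only [parallelFormCoeff, add_mul, ite_mul, zero_mul, Finset.sum_add_distrib,
        Finset.sum_ite_eq', Finset.mem_univ, if_true]
      rw [Finset.sum_comm (f := fun a b ↦ if a = p.1 then _ else _)]
      simp only [Finset.sum_ite_eq', Finset.mem_univ, if_true]
      rw [← Finset.sum_add_distrib, Finset.mul_sum]
      exact Finset.sum_congr rfl fun m _ ↦ by ring)
    (by ext p; simp [h0]) x
  exact sub_eq_zero.1 (congrFun key (i, j))

/-- `F` is a local isometry from the metric `g` to the standard metric, with a parallel
differential. -/
structure IsDeveloping (g : RMetric) (F : R3 → R3) : Prop where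
  contDiff : ContDiff ℝ ∞ F
  inner_fderiv : ∀ x u v, ⟪fderiv ℝ F x u, fderiv ℝ F x v⟫_ℝ = g.inner x u v
  fderiv_fderiv : ∀ x u v a, fderiv ℝ (fderiv ℝ F) x u v a
    = ∑ l, (∑ i, ∑ k, g.christoffel l i k x * u i * v k) * fderiv ℝ F x (coordVec l) a

/-- Factor the metric at the origin as `Bᵀ B` and extend the rows of `B` to parallel forms `θᵃ`.
Then `∑ₐ θᵃ ⊗ θᵃ` is parallel and equals `g` at the origin, hence everywhere; the primitives of the
`θᵃ` are the components of `F`. -/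
theorem IsFlat.exists_isDeveloping (hg : g.IsFlat) : ∃ F, g.IsDeveloping F := by
  obtain ⟨B, hB⟩ : ∃ B : Matrix (Fin 3) (Fin 3) ℝ, g.gram 0 = B.conjTranspose * B :=
    by
    open scoped MatrixOrder in
    exact CStarAlgebra.nonneg_iff_eq_star_mul_self.1 (g.gram_posDef 0).posSemidef.nonneg
  choose f θ hf hθ0 hfθ hθs hθ using fun a : Fin 3 ↦ hg.exists_parallel (B a)
  have hθd : ∀ a k, Differentiable ℝ (θ a k) := fun a k ↦ (hθs a k).differentiable (by simp)
  have hgram : ∀ i j x, ∑ a, θ a i x * θ a j x = g.gram x i j := by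
    refine eq_gram_of_parallel (h := fun i j x ↦ ∑ a, θ a i x * θ a j x) ?_ ?_ ?_
    · intro i j
      fun_prop
    · intro i j x v
      have h1 : HasFDerivAt (fun x ↦ ∑ a, θ a i x * θ a j x)
          (∑ a, (θ a i x • fderiv ℝ (θ a j) x + θ a j x • fderiv ℝ (θ a i) x)) x :=
        HasFDerivAt.fun_sum fun a _ ↦ (hθd a i x).hasFDerivAt.mul (hθd a j x).hasFDerivAt
      rw [h1.fderiv]
      simp only [sum_apply, add_apply, smul_apply, smul_eq_mul, hθ]
      simp only [Fin.sum_univ_three]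
      ring
    · intro i j
      simp [hθ0, hB, Matrix.mul_apply]
  set F : R3 → R3 := fun x ↦ WithLp.toLp 2 fun a ↦ f a x with hF
  have hFs : ContDiff ℝ ∞ F := contDiff_piLp' 2 fun a ↦ hf a
  have hFd : Differentiable ℝ F := hFs.differentiable (by simp)
  have hF1 : ∀ x u a, fderiv ℝ F x u a = ∑ k, u k * θ a k x := by
    intro x u a
    rw [← hfθ]
    have h1 : HasFDerivAt (fun y ↦ F y a) ((EuclideanSpace.proj a : R3 →L[ℝ] ℝ).comp
        (fderiv ℝ F x)) x :=
      (EuclideanSpace.proj a : R3 →L[ℝ] ℝ).hasFDerivAt.comp x (hFd x).hasFDerivAt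
    have h2 : (fun y ↦ F y a) = f a := rfl
    rw [← h2, h1.fderiv]
    rfl
  refine ⟨F, hFs, fun x u v ↦ ?_, fun x u v a ↦ ?_⟩
  · rw [g.inner_eq_sum]
    simp only [← hgram, PiLp.inner_apply, hF1, RCLike.inner_apply, conj_trivial]
    simp only [Fin.sum_univ_three]
    ring
  · have hF' : Differentiable ℝ (fderiv ℝ F) :=
      (hFs.fderiv_right (m := ∞) (by simp)).differentiable (by simp)
    have h1 : HasFDerivAt (fun y ↦ fderiv ℝ F y v a)
        ((EuclideanSpace.proj a : R3 →L[ℝ] ℝ).comp ((fderiv ℝ (fderiv ℝ F) x).flip v)) x := by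
      refine (EuclideanSpace.proj a : R3 →L[ℝ] ℝ).hasFDerivAt.comp x ?_
      refine ((hF' x).hasFDerivAt.clm_apply (hasFDerivAt_const v x)).congr_fderiv ?_
      ext; simp
    have h2 : HasFDerivAt (fun y ↦ fderiv ℝ F y v a) (∑ k, v k • fderiv ℝ (θ a k) x) x := by
      simp only [hF1]
      exact HasFDerivAt.fun_sum fun k _ ↦ (hθd a k x).hasFDerivAt.const_mul (v k)
    have h3 := congrArg (fun L ↦ L u) (h1.unique h2)
    have h4 : fderiv ℝ (fderiv ℝ F) x u v a = ∑ k, v k * fderiv ℝ (θ a k) x u := by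
      simpa [sum_apply] using h3
    rw [h4]
    simp only [hF1, hθ, coordVec_apply]
    simp only [ite_mul, one_mul, zero_mul, Finset.sum_ite_eq', Finset.mem_univ, if_true]
    simp only [Fin.sum_univ_three]
    ring

end RMetric

/-! ### Linear algebra of the first and second derivative at a point -/

section Frames

/-- A unit vector is the first vector of an orthonormal basis. -/
theorem exists_orthonormalBasis_zero {c : R3} (hc : ⟪c, c⟫_ℝ = 1) :
    ∃ B : OrthonormalBasis (Fin 3) ℝ R3, B 0 = c := by
  obtain ⟨B, hB⟩ := Orthonormal.exists_orthonormalBasis_extension_of_card_eq (𝕜 := ℝ) (E := R3)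
    (ι := Fin 3) (by simp) (v := fun _ ↦ c) (s := {0}) (by
      rw [orthonormal_iff_ite]
      rintro ⟨i, rfl⟩ ⟨j, rfl⟩
      simpa using hc)
  exact ⟨B, hB 0 rfl⟩

/-- Two orthonormal vectors are the first vectors of an orthonormal basis. -/
theorem exists_orthonormalBasis_zero_one {c t : R3} (hc : ⟪c, c⟫_ℝ = 1) (ht : ⟪t, t⟫_ℝ = 1)
    (hct : ⟪c, t⟫_ℝ = 0) : ∃ B : OrthonormalBasis (Fin 3) ℝ R3, B 0 = c ∧ B 1 = t := by
  have htc : ⟪t, c⟫_ℝ = 0 := by rw [real_inner_comm, hct]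
  obtain ⟨B, hB⟩ := Orthonormal.exists_orthonormalBasis_extension_of_card_eq (𝕜 := ℝ) (E := R3)
    (ι := Fin 3) (by simp) (v := ![c, t, 0]) (s := {0, 1}) (by
      rw [orthonormal_iff_ite]
      have h01 : ∀ h0 h1, (⟨0, h0⟩ : ({0, 1} : Set (Fin 3))) ≠ ⟨1, h1⟩ := fun _ _ h ↦ by
        simpa using congrArg Subtype.val h
      rintro ⟨i, hi⟩ ⟨j, hj⟩
      obtain rfl | rfl : i = 0 ∨ i = 1 := by simpa using hi
      all_goals obtain rfl | rfl : j = 0 ∨ j = 1 := by simpa using hj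
      · rw [if_pos rfl]; exact hc
      · rw [if_neg (h01 _ _)]; exact hct
      · rw [if_neg (h01 _ _).symm]; exact htc
      · rw [if_pos rfl]; exact ht)
  exact ⟨B, hB 0 (by simp), hB 1 (by simp)⟩

variable (o : Orientation ℝ R3 (Fin 3))

/-- The volume form as a linear form of its first argument. -/
def volLeft (u v : R3) : R3 →L[ℝ] ℝ :=
  LinearMap.toContinuousLinearMap
    ((o.volumeForm.toMultilinearMap).toLinearMap ![0, u, v] 0)

theorem volLeft_apply (u v w : R3) : volLeft o u v w = o.volumeForm ![w, u, v] := by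
  have e : Function.update ![0, u, v] 0 w = ![w, u, v] := by
    ext i : 1
    fin_cases i <;> rfl
  change o.volumeForm (Function.update ![0, u, v] 0 w) = _
  rw [e]

theorem volLeft_self_left (u v : R3) : volLeft o u v u = 0 := by
  rw [volLeft_apply]
  exact o.volumeForm.map_eq_zero_of_eq _ (i := 0) (j := 1) rfl (by decide)

theorem volLeft_self_right (u v : R3) : volLeft o u v v = 0 := by
  rw [volLeft_apply]
  exact o.volumeForm.map_eq_zero_of_eq _ (i := 0) (j := 2) rfl (by decide)

theorem volLeft_rotate (u v w : R3) : volLeft o u v w = volLeft o v w u := by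
  rw [volLeft_apply, volLeft_apply]
  have := o.volumeForm.map_perm ![w, u, v] (finRotate 3)
  rw [sign_finRotate] at this
  have e : ![w, u, v] ∘ finRotate 3 = ![u, v, w] := by
    ext i : 1
    fin_cases i <;> rfl
  rw [e] at this
  simpa using this.symm

theorem volLeft_basis_sq (B : OrthonormalBasis (Fin 3) ℝ R3) :
    volLeft o (B 1) (B 2) (B 0) ^ 2 = 1 := by
  rw [volLeft_apply, ← sq_abs]
  have e : ![B 0, B 1, B 2] = B := by
    ext i : 1
    fin_cases i <;> rfl
  rw [e, o.abs_volumeForm_apply_of_orthonormal B, one_pow]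

theorem eq_sum_basis (B : OrthonormalBasis (Fin 3) ℝ R3) (a : R3) :
    a = ⟪a, B 0⟫_ℝ • B 0 + ⟪a, B 1⟫_ℝ • B 1 + ⟪a, B 2⟫_ℝ • B 2 := by
  conv_lhs => rw [← B.sum_repr' a]
  simp only [Fin.sum_univ_three, real_inner_comm]

theorem basis_ext (B : OrthonormalBasis (Fin 3) ℝ R3) {a b : R3} (h0 : ⟪a, B 0⟫_ℝ = ⟪b, B 0⟫_ℝ)
    (h1 : ⟪a, B 1⟫_ℝ = ⟪b, B 1⟫_ℝ) (h2 : ⟪a, B 2⟫_ℝ = ⟪b, B 2⟫_ℝ) : a = b := by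
  rw [eq_sum_basis B a, eq_sum_basis B b, h0, h1, h2]

/-- An endomorphism that acts on the volume form as zero has trace zero. -/
theorem trace_eq_zero_of_vol {M : R3 → R3}
    (hM : ∀ u v w, volLeft o u v (M w) + volLeft o v w (M u) + volLeft o w u (M v) = 0)
    (B : OrthonormalBasis (Fin 3) ℝ R3) :
    ⟪M (B 0), B 0⟫_ℝ + ⟪M (B 1), B 1⟫_ℝ + ⟪M (B 2), B 2⟫_ℝ = 0 := by
  have h := hM (B 1) (B 2) (B 0)
  rw [eq_sum_basis B (M (B 0)), eq_sum_basis B (M (B 1)), eq_sum_basis B (M (B 2))] at h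
  simp only [map_add, map_smul, volLeft_self_left, volLeft_self_right, smul_eq_mul, mul_zero,
    zero_add, add_zero] at h
  rw [← volLeft_rotate o (B 1) (B 2) (B 0), volLeft_rotate o (B 0) (B 1) (B 2)] at h
  have hs := volLeft_basis_sq o B
  have hs0 : volLeft o (B 1) (B 2) (B 0) ≠ 0 := fun h0 ↦ by simp [h0] at hs
  have : (⟪M (B 0), B 0⟫_ℝ + ⟪M (B 1), B 1⟫_ℝ + ⟪M (B 2), B 2⟫_ℝ)
      * volLeft o (B 1) (B 2) (B 0) = 0 := by linarith
  exact (mul_eq_zero.1 this).resolve_right hs0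

theorem basis_inner (B : OrthonormalBasis (Fin 3) ℝ R3) (i j : Fin 3) :
    ⟪B i, B j⟫_ℝ = if i = j then 1 else 0 := by
  simpa using orthonormal_iff_ite.1 B.orthonormal i j

/-- An endomorphism of `ℝ³` with `A b = 0`, image in `b^⊥`, and with `tr A = tr A² = 0` has square
zero. -/
theorem sq_eq_zero_of_trace {A : R3 →L[ℝ] R3} {b : R3} (hb : ⟪b, b⟫_ℝ = 1) (hAb : A b = 0)
    (hbA : ∀ u, ⟪A u, b⟫_ℝ = 0)
    (ht : ∀ B : OrthonormalBasis (Fin 3) ℝ R3,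
      ⟪A (B 0), B 0⟫_ℝ + ⟪A (B 1), B 1⟫_ℝ + ⟪A (B 2), B 2⟫_ℝ = 0)
    (ht2 : ∀ B : OrthonormalBasis (Fin 3) ℝ R3,
      ⟪A (A (B 0)), B 0⟫_ℝ + ⟪A (A (B 1)), B 1⟫_ℝ + ⟪A (A (B 2)), B 2⟫_ℝ = 0) (u : R3) :
    A (A u) = 0 := by
  obtain ⟨B, rfl⟩ := exists_orthonormalBasis_zero hb
  have h1 : ∀ i, A (B i) = ⟪A (B i), B 1⟫_ℝ • B 1 + ⟪A (B i), B 2⟫_ℝ • B 2 := fun i ↦ by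
    conv_lhs => rw [eq_sum_basis B (A (B i)), hbA, zero_smul, zero_add]
  have ht' := ht B
  have ht2' := ht2 B
  rw [hAb, inner_zero_left, zero_add] at ht'
  rw [hAb, map_zero, inner_zero_left, zero_add] at ht2'
  have hA1 : A (A (B 1)) = ⟪A (B 1), B 1⟫_ℝ • A (B 1) + ⟪A (B 1), B 2⟫_ℝ • A (B 2) := by
    conv_lhs => rw [h1 1]
    simp
  have hA2 : A (A (B 2)) = ⟪A (B 2), B 1⟫_ℝ • A (B 1) + ⟪A (B 2), B 2⟫_ℝ • A (B 2) := by
    conv_lhs => rw [h1 2]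
    simp
  rw [hA1, hA2] at ht2'
  simp only [inner_add_left, real_inner_smul_left] at ht2'
  have hd : ⟪A (B 2), B 2⟫_ℝ = -⟪A (B 1), B 1⟫_ℝ := by linarith
  rw [hd] at ht2'
  -- On `b^⊥` the trace-free block `(p, q; r, -p)` has square `(p² + q r) · 1`, and `tr A² = 2 (p² +
  -- q r)` vanishes.
  have z1 : A (A (B 1)) = 0 := by
    rw [hA1]
    refine basis_ext B ?_ ?_ ?_ <;>
      simp only [inner_add_left, real_inner_smul_left, inner_zero_left, hbA, hd] <;> linarith
  have z2 : A (A (B 2)) = 0 := by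
    rw [hA2]
    refine basis_ext B ?_ ?_ ?_ <;>
      simp only [inner_add_left, real_inner_smul_left, inner_zero_left, hbA, hd] <;> linarith
  rw [eq_sum_basis B u]
  simp [hAb, z1, z2]

/-- The normal form of the derivative of a unit Beltrami field at a point. -/
theorem exists_basis_of_sq_eq_zero {A : R3 →L[ℝ] R3} {b : R3} {μ : ℝ} (hμ : μ ≠ 0)
    (hb : ⟪b, b⟫_ℝ = 1) (hAb : A b = 0) (hbA : ∀ u, ⟪A u, b⟫_ℝ = 0)
    (ht : ∀ B : OrthonormalBasis (Fin 3) ℝ R3,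
      ⟪A (B 0), B 0⟫_ℝ + ⟪A (B 1), B 1⟫_ℝ + ⟪A (B 2), B 2⟫_ℝ = 0)
    (hsq : ∀ u, A (A u) = 0)
    (hcurl : ∀ u v, ⟪A u, v⟫_ℝ - ⟪A v, u⟫_ℝ = μ * volLeft o u v b) :
    ∃ (B : OrthonormalBasis (Fin 3) ℝ R3) (m : ℝ), B 0 = b ∧ A (B 1) = 0 ∧ A (B 2) = m • B 1 ∧
      m ^ 2 = μ ^ 2 := by
  -- If `A` were zero the curl would vanish, but it is `±μ` on `(B 1, B 2)`.
  obtain ⟨v, hv⟩ : ∃ v, A v ≠ 0 := by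
    by_contra! h
    obtain ⟨B, rfl⟩ := exists_orthonormalBasis_zero hb
    have h1 := hcurl (B 1) (B 2)
    have hs := volLeft_basis_sq o B
    simp only [h, inner_zero_left, sub_zero] at h1
    rcases mul_eq_zero.1 h1.symm with h2 | h2
    · exact hμ h2
    · simp [h2] at hs
  have hn : ‖A v‖ ≠ 0 := norm_ne_zero_iff.2 hv
  -- `B 1` is taken in the image of `A`, so `A² = 0` gives `A (B 1) = 0`.
  obtain ⟨B, hB0, hB1⟩ := exists_orthonormalBasis_zero_one hb (t := ‖A v‖⁻¹ • A v)
    (by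
      rw [real_inner_smul_left, real_inner_smul_right, real_inner_self_eq_norm_sq]
      field_simp)
    (by rw [real_inner_smul_right, real_inner_comm, hbA, mul_zero])
  have hA1 : A (B 1) = 0 := by rw [hB1, map_smul, hsq, smul_zero]
  have ht' := ht B
  rw [hB0, hAb, hA1, inner_zero_left, inner_zero_left, zero_add, zero_add] at ht'
  refine ⟨B, ⟪A (B 2), B 1⟫_ℝ, hB0, hA1, ?_, ?_⟩
  · conv_lhs => rw [eq_sum_basis B (A (B 2)), ht', hB0, hbA]
    simp
  · have h1 := hcurl (B 1) (B 2)
    have hs := volLeft_basis_sq o B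
    rw [hA1, inner_zero_left, ← hB0] at h1
    have : ⟪A (B 2), B 1⟫_ℝ = -(μ * volLeft o (B 1) (B 2) (B 0)) := by linarith
    rw [this, neg_sq, mul_pow, hs, mul_one]

/-- The second derivative of a unit Beltrami field, from the normal form of the first one. -/
theorem second_derivative_eq {A : R3 →L[ℝ] R3} {C : R3 →L[ℝ] R3 →L[ℝ] R3} {m μ : ℝ} (hm : m ≠ 0)
    (B : OrthonormalBasis (Fin 3) ℝ R3)
    (hA0 : A (B 0) = 0) (hA1 : A (B 1) = 0) (hA2 : A (B 2) = m • B 1)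
    (hC : ∀ u v, C u v = C v u)
    (hCb : ∀ w u, ⟪C w u, B 0⟫_ℝ + ⟪A u, A w⟫_ℝ = 0)
    (hC0 : ∀ w, C w (B 0) = 0)
    (hcurl : ∀ w u v, ⟪C w u, v⟫_ℝ - ⟪C w v, u⟫_ℝ = μ * volLeft o u v (A w))
    (hsq : ∀ w u, C w (A u) + A (C w u) = 0) (w u : R3) :
    C w u = -⟪A w, A u⟫_ℝ • B 0 := by
  have hAu : ∀ u, A u = (m * ⟪u, B 2⟫_ℝ) • B 1 := fun u ↦ by
    conv_lhs => rw [eq_sum_basis B u]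
    simp [hA0, hA1, hA2, smul_smul, mul_comm]
  -- The derivative of `A² = 0` on `B 1` and, below, on `B 2` constrains the block of `C w` on
  -- `b^⊥`. The differentiated curl equation and the symmetry of `C` remove what is left.
  have hN : ∀ w, ⟪C w (B 1), B 2⟫_ℝ = 0 := fun w ↦ by
    have := hsq w (B 1)
    rw [hA1, map_zero, zero_add, hAu] at this
    have := congrArg (fun z ↦ ⟪z, B 1⟫_ℝ) this
    simpa [real_inner_smul_left, hm] using this
  have hTN : ∀ w, ⟪C w (B 1), B 1⟫_ℝ + ⟪C w (B 2), B 2⟫_ℝ = 0 := fun w ↦ by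
    have := hsq w (B 2)
    rw [hA2, map_smul, hAu] at this
    have := congrArg (fun z ↦ ⟪z, B 1⟫_ℝ) this
    simp only [inner_add_left, real_inner_smul_left, basis_inner, inner_zero_left, if_true,
      mul_one] at this
    rw [← mul_add] at this
    exact (mul_eq_zero.1 this).resolve_left hm
  have c21 : ⟪C (B 2) (B 1), B 1⟫_ℝ = 0 := by
    have h1 := hcurl (B 1) (B 2) (B 1)
    rw [hA1, map_zero, mul_zero, hN, sub_zero] at h1
    rw [hC, h1]
  have key : ∀ i j, ⟪C (B i) (B j), B 1⟫_ℝ = 0 ∧ ⟪C (B i) (B j), B 2⟫_ℝ = 0 := by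
    have c11 : ⟪C (B 1) (B 1), B 1⟫_ℝ = 0 := by
      have := hTN (B 1)
      rw [hC (B 1) (B 2), hN] at this
      linarith
    have c22 : ⟪C (B 2) (B 2), B 2⟫_ℝ = 0 := by
      have := hTN (B 2)
      linarith
    have c22' : ⟪C (B 2) (B 2), B 1⟫_ℝ = 0 := by
      have := hcurl (B 2) (B 2) (B 1)
      rw [hN, hA2, map_smul, volLeft_self_right, smul_zero, mul_zero] at this
      linarith
    intro i j
    fin_cases i <;> fin_cases j
    · simp [hC0]
    · simp [hC (B 0) (B 1), hC0]
    · simp [hC (B 0) (B 2), hC0]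
    · simp [hC0]
    · exact ⟨c11, hN _⟩
    · simp only [Fin.mk_one, Fin.reduceFinMk]
      rw [hC (B 1) (B 2)]
      exact ⟨c21, hN _⟩
    · simp [hC0]
    · exact ⟨c21, hN _⟩
    · exact ⟨c22', c22⟩
  have key' : ∀ i j, C (B i) (B j) = -⟪A (B i), A (B j)⟫_ℝ • B 0 := fun i j ↦ by
    refine basis_ext B ?_ ?_ ?_
    · have := hCb (B i) (B j)
      rw [real_inner_smul_left, basis_inner, if_pos rfl,
        real_inner_comm (A (B j)) (A (B i))]
      linarith
    · rw [(key i j).1, real_inner_smul_left, basis_inner]; simp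
    · rw [(key i j).2, real_inner_smul_left, basis_inner]; simp
  rw [eq_sum_basis B w, eq_sum_basis B u]
  simp only [map_add, map_smul, add_apply, smul_apply, key', inner_add_left, inner_add_right,
    real_inner_smul_left, real_inner_smul_right]
  module

end Frames

/-! ### Unit Beltrami fields on flat space -/

/-- A unit vector field `b` on flat space that satisfies `curl b = μ b`. Derivatives are taken with
respect to the coframe `P` of `ℝ³`; the first and second derivative of `b` are `A` and `C`. -/
structure IsBeltramiField (o : Orientation ℝ R3 (Fin 3)) (μ : ℝ) (P : R3 → R3 →L[ℝ] R3)
    (b : R3 → R3) (A : R3 → R3 →L[ℝ] R3) (C : R3 → R3 →L[ℝ] R3 →L[ℝ] R3) : Prop where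
  surjective : ∀ x, Function.Surjective (P x)
  hasFDerivAt : ∀ x, HasFDerivAt b ((A x).comp (P x)) x
  hasFDerivAt_deriv : ∀ x, HasFDerivAt A ((C x).comp (P x)) x
  symm : ∀ x u v, C x u v = C x v u
  unit : ∀ x, ⟪b x, b x⟫_ℝ = 1
  curl : ∀ x u v, ⟪A x u, v⟫_ℝ - ⟪A x v, u⟫_ℝ = μ * volLeft o u v (b x)

/-- The device by which each pointwise identity below is differentiated; surjectivity of `P x` then
yields every direction. -/
theorem fderiv_apply_eq_zero_of_const {G : Type*} [NormedAddCommGroup G] [NormedSpace ℝ G]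
    {f : R3 → G} {f' : R3 →L[ℝ] G} {x : R3} (hf : HasFDerivAt f f' x) {c : G}
    (hc : ∀ y, f y = c) (h : R3) : f' h = 0 := by
  have : f = fun _ ↦ c := funext hc
  rw [hf.unique (this ▸ hasFDerivAt_const c x), zero_apply]

namespace IsBeltramiField

variable {o : Orientation ℝ R3 (Fin 3)} {μ : ℝ} {P : R3 → R3 →L[ℝ] R3}
  {b : R3 → R3} {A : R3 → R3 →L[ℝ] R3} {C : R3 → R3 →L[ℝ] R3 →L[ℝ] R3}

theorem hasFDerivAt_deriv_apply (H : IsBeltramiField o μ P b A C) (x u : R3) :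
    HasFDerivAt (fun y ↦ A y u) (((C x).comp (P x)).flip u) x := by
  refine ((H.hasFDerivAt_deriv x).clm_apply (hasFDerivAt_const u x)).congr_fderiv ?_
  ext; simp

theorem inner_deriv_self (H : IsBeltramiField o μ P b A C) (x u : R3) :
    ⟪A x u, b x⟫_ℝ = 0 := by
  obtain ⟨h, rfl⟩ := H.surjective x u
  have := fderiv_apply_eq_zero_of_const ((H.hasFDerivAt x).inner ℝ (H.hasFDerivAt x)) H.unit h
  simp only [ContinuousLinearMap.comp_apply, ContinuousLinearMap.prod_apply, fderivInnerCLM_apply,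
    real_inner_comm (A x _) (b x)] at this
  linarith

/-- The curl equation on `b` and `A b`: the volume term has a repeated entry and `⟪A (A b), b⟫ = 0`,
which leaves `⟪A b, A b⟫ = 0`. -/
theorem deriv_self (H : IsBeltramiField o μ P b A C) (x : R3) : A x (b x) = 0 := by
  have := H.curl x (b x) (A x (b x))
  rw [H.inner_deriv_self, volLeft_self_left, mul_zero, sub_zero] at this
  exact inner_self_eq_zero.1 this

theorem inner_second_deriv_self (H : IsBeltramiField o μ P b A C) (x w u : R3) :
    ⟪C x w u, b x⟫_ℝ + ⟪A x u, A x w⟫_ℝ = 0 := by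
  obtain ⟨h, rfl⟩ := H.surjective x w
  have := fderiv_apply_eq_zero_of_const
    ((H.hasFDerivAt_deriv_apply x u).inner ℝ (H.hasFDerivAt x))
    (fun y ↦ H.inner_deriv_self y u) h
  simp only [ContinuousLinearMap.comp_apply, ContinuousLinearMap.prod_apply, fderivInnerCLM_apply,
    ContinuousLinearMap.flip_apply] at this
  linarith

theorem second_deriv_self (H : IsBeltramiField o μ P b A C) (x w : R3) :
    C x w (b x) + A x (A x w) = 0 := by
  obtain ⟨h, rfl⟩ := H.surjective x w
  have := fderiv_apply_eq_zero_of_const ((H.hasFDerivAt_deriv x).clm_apply (H.hasFDerivAt x))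
    H.deriv_self h
  simp only [add_apply, ContinuousLinearMap.comp_apply, ContinuousLinearMap.flip_apply] at this
  rwa [add_comm] at this

theorem curl_deriv (H : IsBeltramiField o μ P b A C) (x w u v : R3) :
    ⟪C x w u, v⟫_ℝ - ⟪C x w v, u⟫_ℝ = μ * volLeft o u v (A x w) := by
  obtain ⟨h, rfl⟩ := H.surjective x w
  have h1 := ((H.hasFDerivAt_deriv_apply x u).inner ℝ (hasFDerivAt_const v x)).sub
    ((H.hasFDerivAt_deriv_apply x v).inner ℝ (hasFDerivAt_const u x))
  have h2 := ((volLeft o u v).hasFDerivAt.comp x (H.hasFDerivAt x)).const_mul μ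
  have := fderiv_apply_eq_zero_of_const (h1.sub h2) (fun y ↦ sub_eq_zero.2 (H.curl y u v)) h
  simp only [sub_apply, smul_apply, ContinuousLinearMap.comp_apply,
    ContinuousLinearMap.prod_apply, fderivInnerCLM_apply, ContinuousLinearMap.flip_apply,
    zero_apply, inner_zero_right, zero_add, smul_eq_mul] at this
  linarith

/-- This is `div b = 0`: in the cyclic sum of the differentiated curl equations the second
derivatives cancel by symmetry. -/
theorem vol_deriv (H : IsBeltramiField o μ P b A C) (hμ : μ ≠ 0) (x u v w : R3) :
    volLeft o u v (A x w) + volLeft o v w (A x u) + volLeft o w u (A x v) = 0 := by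
  have h1 := H.curl_deriv x w u v
  have h2 := H.curl_deriv x u v w
  have h3 := H.curl_deriv x v w u
  rw [H.symm x w v] at h1
  rw [H.symm x u w] at h2
  rw [H.symm x v u] at h3
  have : μ * (volLeft o u v (A x w) + volLeft o v w (A x u) + volLeft o w u (A x v)) = 0 := by
    linarith
  exact (mul_eq_zero.1 this).resolve_left hμ

theorem vol_second_deriv (H : IsBeltramiField o μ P b A C) (hμ : μ ≠ 0) (x z u v w : R3) :
    volLeft o u v (C x z w) + volLeft o v w (C x z u) + volLeft o w u (C x z v) = 0 := by
  obtain ⟨h, rfl⟩ := H.surjective x z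
  have h1 := fun u v w ↦ (volLeft o u v).hasFDerivAt.comp x (H.hasFDerivAt_deriv_apply x w)
  exact fderiv_apply_eq_zero_of_const (((h1 u v w).add (h1 v w u)).add (h1 w u v))
    (fun y ↦ H.vol_deriv hμ y u v w) h

/-- Since `A² w = -C b w`, the trace of `A²` is minus the derivative of `tr A = 0` along `b`. -/
theorem deriv_deriv (H : IsBeltramiField o μ P b A C) (hμ : μ ≠ 0) (x u : R3) :
    A x (A x u) = 0 := by
  refine sq_eq_zero_of_trace (H.unit x) (H.deriv_self x) (H.inner_deriv_self x)
    (trace_eq_zero_of_vol o (H.vol_deriv hμ x)) ?_ u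
  refine trace_eq_zero_of_vol o (M := fun u ↦ A x (A x u)) fun u v w ↦ ?_
  have hC : ∀ w, A x (A x w) = -C x (b x) w := fun w ↦ by
    rw [H.symm, eq_neg_iff_add_eq_zero, add_comm]
    exact H.second_deriv_self x w
  simp only [hC, map_neg]
  linarith [H.vol_second_deriv hμ x (b x) u v w]

theorem second_deriv_deriv (H : IsBeltramiField o μ P b A C) (hμ : μ ≠ 0) (x w u : R3) :
    C x w (A x u) + A x (C x w u) = 0 := by
  obtain ⟨h, rfl⟩ := H.surjective x w
  have := fderiv_apply_eq_zero_of_const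
    ((H.hasFDerivAt_deriv x).clm_apply (H.hasFDerivAt_deriv_apply x u))
    (fun y ↦ H.deriv_deriv hμ y u) h
  simp only [add_apply, ContinuousLinearMap.comp_apply, ContinuousLinearMap.flip_apply] at this
  rwa [add_comm] at this

theorem exists_normal_form (H : IsBeltramiField o μ P b A C) (hμ : μ ≠ 0) (x : R3) :
    ∃ (B : OrthonormalBasis (Fin 3) ℝ R3) (m : ℝ), B 0 = b x ∧ A x (B 1) = 0 ∧
      A x (B 2) = m • B 1 ∧ m ^ 2 = μ ^ 2 :=
  exists_basis_of_sq_eq_zero o hμ (H.unit x) (H.deriv_self x) (H.inner_deriv_self x)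
    (trace_eq_zero_of_vol o (H.vol_deriv hμ x)) (H.deriv_deriv hμ x) (H.curl x)

theorem second_deriv_eq (H : IsBeltramiField o μ P b A C) (hμ : μ ≠ 0) (x w u : R3) :
    C x w u = -⟪A x w, A x u⟫_ℝ • b x := by
  obtain ⟨B, m, hB, hA1, hA2, hm⟩ := H.exists_normal_form hμ x
  have hm0 : m ≠ 0 := fun h ↦ hμ (by simpa [h] using hm.symm)
  rw [← hB]
  refine second_derivative_eq o hm0 B (hB ▸ H.deriv_self x) hA1 hA2 (H.symm x)
    (hB ▸ H.inner_second_deriv_self x) (fun w ↦ ?_) (H.curl_deriv x) (H.second_deriv_deriv hμ x) w u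
  have := H.second_deriv_self x w
  rwa [H.deriv_deriv hμ, add_zero, ← hB] at this

/-- The derivative of `A` takes values in multiples of `b`, which are orthogonal to the image of
`A`. -/
theorem inner_deriv_deriv_eq (H : IsBeltramiField o μ P b A C) (hμ : μ ≠ 0) (x y u v : R3) :
    ⟪A x u, A x v⟫_ℝ = ⟪A y u, A y v⟫_ℝ := by
  have hd : ∀ x, HasFDerivAt (fun x ↦ ⟪A x u, A x v⟫_ℝ) (0 : R3 →L[ℝ] ℝ) x := fun x ↦ by
    refine ((H.hasFDerivAt_deriv_apply x u).inner ℝ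
      (H.hasFDerivAt_deriv_apply x v)).congr_fderiv ?_
    ext h
    simp only [ContinuousLinearMap.comp_apply, ContinuousLinearMap.prod_apply,
      fderivInnerCLM_apply, ContinuousLinearMap.flip_apply, H.second_deriv_eq hμ, zero_apply,
      real_inner_smul_left, real_inner_smul_right, H.inner_deriv_self,
      real_inner_comm (A x _) (b x), mul_zero, add_zero]
  exact is_const_of_fderiv_eq_zero (fun x ↦ (hd x).differentiableAt) (fun x ↦ (hd x).fderiv) x y

/-- A unit Beltrami field on flat space is a standard one: it rotates with constant speed along
a parallel direction. -/
theorem exists_eq_sin_cos (H : IsBeltramiField o μ P b A C) (hμ : μ ≠ 0) {F : R3 → R3}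
    (hF : ∀ x, HasFDerivAt F (P x) x) {s : ℝ} (hs : s * s = 1) :
    ∃ B : OrthonormalBasis (Fin 3) ℝ R3, ∀ x,
      b x = Real.sin (μ * s * ⟪B 2, F x⟫_ℝ) • B 0 + Real.cos (μ * s * ⟪B 2, F x⟫_ℝ) • B 1 := by
  obtain ⟨B, m, hB, hA1, hA2, hm⟩ := H.exists_normal_form hμ 0
  have hA0 : A 0 (B 0) = 0 := hB ▸ H.deriv_self 0
  set N := B 2 with hN
  have hNN : ⟪N, N⟫_ℝ = 1 := by rw [hN, basis_inner, if_pos rfl]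
  have hA' : ∀ u, A 0 u = (⟪u, N⟫_ℝ * m) • B 1 := fun u ↦ by
    conv_lhs => rw [eq_sum_basis B u]
    simp [hA0, hA1, ← hN, hA2, smul_smul]
  have hK : ∀ x u v, ⟪A x u, A x v⟫_ℝ = μ ^ 2 * ⟪u, N⟫_ℝ * ⟪v, N⟫_ℝ := fun x u v ↦ by
    rw [H.inner_deriv_deriv_eq hμ x 0, hA', hA', real_inner_smul_left, real_inner_smul_right,
      basis_inner, if_pos rfl]
    linear_combination ⟪u, N⟫_ℝ * ⟪v, N⟫_ℝ * hm
  -- By `hK` the vector `A x (u - ⟪N, u⟫ • N)` has length zero.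
  have hA : ∀ x u, A x u = ⟪N, u⟫_ℝ • A x N := fun x u ↦ by
    rw [← sub_eq_zero, ← map_smul, ← map_sub, ← inner_self_eq_zero (𝕜 := ℝ), hK, inner_sub_left,
      real_inner_smul_left, hNN, real_inner_comm N u]
    ring
  -- With phase `h` and companion `T` the equations become `db = dh ⊗ T` and `dT = -dh ⊗ b`; turning
  -- the pair back by the angle `h` gives two constant vectors `p` and `q`.
  set h : R3 → ℝ := fun x ↦ μ * ⟪N, F x⟫_ℝ with hh
  set T : R3 → R3 := fun x ↦ μ⁻¹ • A x N with hT
  set h' : R3 → R3 →L[ℝ] ℝ := fun x ↦ μ • (innerSL ℝ N).comp (P x) with hh'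
  have dh : ∀ x, HasFDerivAt h (h' x) x := fun x ↦
    ((innerSL ℝ N).hasFDerivAt.comp x (hF x)).const_mul μ
  have db : ∀ x, HasFDerivAt b ((h' x).smulRight (T x)) x := fun x ↦ by
    refine (H.hasFDerivAt x).congr_fderiv ?_
    ext1 k
    simp only [ContinuousLinearMap.comp_apply, ContinuousLinearMap.smulRight_apply, hh', hT,
      smul_apply, smul_smul, smul_eq_mul, innerSL_apply_apply]
    rw [hA x (P x k)]
    congr 1
    field_simp
  have dT : ∀ x, HasFDerivAt T (-(h' x).smulRight (b x)) x := fun x ↦ by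
    refine ((H.hasFDerivAt_deriv_apply x N).const_smul μ⁻¹).congr_fderiv ?_
    ext1 k
    simp only [ContinuousLinearMap.comp_apply, ContinuousLinearMap.smulRight_apply, hh',
      smul_apply, smul_smul, smul_eq_mul, innerSL_apply_apply, neg_apply,
      ContinuousLinearMap.flip_apply, H.second_deriv_eq hμ, hK, hNN, real_inner_comm N]
    rw [← neg_smul]
    congr 1
    field_simp
  have constP : ∀ x, Real.cos (h x) • b x - Real.sin (h x) • T x
      = Real.cos (h 0) • b 0 - Real.sin (h 0) • T 0 := by
    have hd : ∀ x, HasFDerivAt (fun x ↦ Real.cos (h x) • b x - Real.sin (h x) • T x)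
        (0 : R3 →L[ℝ] R3) x := fun x ↦ by
      refine (((dh x).cos.smul (db x)).sub ((dh x).sin.smul (dT x))).congr_fderiv ?_
      ext1 k
      simp only [sub_apply, add_apply, smul_apply, neg_apply,
        ContinuousLinearMap.smulRight_apply, zero_apply, smul_eq_mul]
      module
    exact fun x ↦ is_const_of_fderiv_eq_zero (fun x ↦ (hd x).differentiableAt)
      (fun x ↦ (hd x).fderiv) x 0
  have constQ : ∀ x, Real.sin (h x) • b x + Real.cos (h x) • T x
      = Real.sin (h 0) • b 0 + Real.cos (h 0) • T 0 := by
    have hd : ∀ x, HasFDerivAt (fun x ↦ Real.sin (h x) • b x + Real.cos (h x) • T x)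
        (0 : R3 →L[ℝ] R3) x := fun x ↦ by
      refine (((dh x).sin.smul (db x)).add ((dh x).cos.smul (dT x))).congr_fderiv ?_
      ext1 k
      simp only [add_apply, smul_apply, neg_apply,
        ContinuousLinearMap.smulRight_apply, zero_apply, smul_eq_mul]
      module
    exact fun x ↦ is_const_of_fderiv_eq_zero (fun x ↦ (hd x).differentiableAt)
      (fun x ↦ (hd x).fderiv) x 0
  set p := Real.cos (h 0) • b 0 - Real.sin (h 0) • T 0 with hp
  set q := Real.sin (h 0) • b 0 + Real.cos (h 0) • T 0 with hq
  have hbb := H.unit 0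
  have hbT : ⟪b 0, T 0⟫_ℝ = 0 := by
    rw [hT, real_inner_smul_right, real_inner_comm, H.inner_deriv_self, mul_zero]
  have hTb : ⟪T 0, b 0⟫_ℝ = 0 := by rw [real_inner_comm, hbT]
  have hTT : ⟪T 0, T 0⟫_ℝ = 1 := by
    rw [hT, real_inner_smul_right, real_inner_smul_left, hK, hNN]
    field_simp
  have hbN : ⟪b 0, N⟫_ℝ = 0 := by rw [← hB, hN, basis_inner, if_neg (by decide)]
  have hTN : ⟪T 0, N⟫_ℝ = 0 := by
    change ⟪μ⁻¹ • A 0 N, N⟫_ℝ = 0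
    rw [hA2, real_inner_smul_left, real_inner_smul_left, hN, basis_inner,
      if_neg (by decide), mul_zero, mul_zero]
  have hsc := Real.sin_sq_add_cos_sq (h 0)
  have hpp : ⟪p, p⟫_ℝ = 1 := by
    simp only [hp, inner_sub_left, inner_sub_right, real_inner_smul_left, real_inner_smul_right,
      hbb, hbT, hTb, hTT]
    linear_combination hsc
  have hqq : ⟪q, q⟫_ℝ = 1 := by
    simp only [hq, inner_add_left, inner_add_right, real_inner_smul_left, real_inner_smul_right,
      hbb, hbT, hTb, hTT]
    linear_combination hsc
  have hqp : ⟪q, p⟫_ℝ = 0 := by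
    simp only [hp, hq, inner_add_left, inner_sub_right, real_inner_smul_left,
      real_inner_smul_right, hbb, hbT, hTb, hTT]
    ring
  have hpN : ⟪p, N⟫_ℝ = 0 := by
    simp only [hp, inner_sub_left, real_inner_smul_left, hbN, hTN]; ring
  have hqN : ⟪q, N⟫_ℝ = 0 := by
    simp only [hq, inner_add_left, real_inner_smul_left, hbN, hTN]; ring
  -- The third basis vector is `s • N`, so that the sign in the phase cancels by `s * s = 1`.
  have hsN : ⟪s • N, s • N⟫_ℝ = 1 := by
    rw [real_inner_smul_left, real_inner_smul_right, hNN, mul_one, hs]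
  have hpN' : ⟪p, s • N⟫_ℝ = 0 := by rw [real_inner_smul_right, hpN, mul_zero]
  have hqN' : ⟪q, s • N⟫_ℝ = 0 := by rw [real_inner_smul_right, hqN, mul_zero]
  have hon : Orthonormal ℝ ![q, p, s • N] := by
    rw [orthonormal_iff_ite]
    intro i j
    fin_cases i <;> fin_cases j <;> simp only [Fin.zero_eta, Fin.mk_one, Fin.reduceFinMk,
      Matrix.cons_val, if_true, hqq, hpp, hsN, hqp, hpN', hqN', real_inner_comm q,
      real_inner_comm p] <;> simp
  obtain ⟨B', hB'⟩ := Orthonormal.exists_orthonormalBasis_extension_of_card_eq (𝕜 := ℝ) (E := R3)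
    (ι := Fin 3) (by simp) (v := ![q, p, s • N]) (s := univ) (hon.comp _ Subtype.val_injective)
  refine ⟨B', fun x ↦ ?_⟩
  have e0 : B' 0 = q := hB' 0 trivial
  have e1 : B' 1 = p := hB' 1 trivial
  have e2 : B' 2 = s • N := hB' 2 trivial
  have e3 : μ * s * ⟪s • N, F x⟫_ℝ = h x := by
    rw [real_inner_smul_left, hh]
    linear_combination μ * ⟪N, F x⟫_ℝ * hs
  rw [e0, e1, e2, e3, ← constP x, ← constQ x]
  change b x = Real.sin (h x) • _ + Real.cos (h x) • _
  have hx := Real.sin_sq_add_cos_sq (h x)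
  calc b x = (Real.sin (h x) ^ 2 + Real.cos (h x) ^ 2) • b x := by rw [hx, one_smul]
    _ = _ := by module

end IsBeltramiField

/-! ### From adapted contact forms to Beltrami fields -/

/-- A smooth map with invertible differentials is a local diffeomorphism. -/
theorem isLocalDiffeomorph_of_fderiv_equiv {φ : R3 → R3} (hφ : ContDiff ℝ ∞ φ)
    (e : R3 → R3 ≃L[ℝ] R3) (he : ∀ x, fderiv ℝ φ x = e x) :
    IsLocalDiffeomorph 𝓘(ℝ, R3) 𝓘(ℝ, R3) ∞ φ := by
  intro x
  have hd : ∀ y, HasFDerivAt φ (e y : R3 →L[ℝ] R3) y := fun y ↦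
    he y ▸ (hφ.differentiable (by simp) y).hasFDerivAt
  set Φ := hφ.contDiffAt.toOpenPartialHomeomorph φ (hd x) (by simp) with hΦ
  have hcoe : (Φ : R3 → R3) = φ := rfl
  refine ⟨{ toPartialEquiv := Φ.toPartialEquiv
            open_source := Φ.open_source
            open_target := Φ.open_target
            contMDiffOn_toFun := hφ.contMDiff.contMDiffOn
            contMDiffOn_invFun := ?_ },
    hφ.contDiffAt.mem_toOpenPartialHomeomorph_source (hd x) (by simp), fun _ _ ↦ rfl⟩
  rw [contMDiffOn_iff_contDiffOn]
  intro y hy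
  exact (Φ.contDiffAt_symm hy (hcoe ▸ hd (Φ.symm y)) (hcoe ▸ hφ.contDiffAt)).contDiffWithinAt

theorem d_apply {α : R3 → R3 →L[ℝ] ℝ} (hα : Differentiable ℝ α) (x u v : R3) :
    d α x u v = fderiv ℝ α x u v - fderiv ℝ α x v u := by
  have hd : DifferentiableAt ℝ
      (fun y ↦ ContinuousAlternatingMap.ofSubsingleton ℝ R3 ℝ (0 : Fin 1) (α y)) x :=
    ((ContinuousAlternatingMap.ofSubsingletonLIE (𝕜 := ℝ) (E := R3) (F := ℝ) (ι := Fin 1)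
      (i := 0)).differentiable _).comp x (hα x)
  have h2 : ∀ w : R3, fderiv ℝ (fun y ↦ α y w) x = (fderiv ℝ α x).flip w := fun w ↦ by
    refine HasFDerivAt.fderiv (((hα x).hasFDerivAt.clm_apply
      (hasFDerivAt_const w x)).congr_fderiv ?_)
    ext; simp
  rw [d, extDeriv_apply hd]
  simp only [ContinuousAlternatingMap.ofSubsingleton_apply_apply]
  simp [Fin.removeNth, h2, sub_eq_add_neg]

theorem volumeForm_map (o : Orientation ℝ R3 (Fin 3)) (L : R3 →L[ℝ] R3) (u v w : R3) :
    o.volumeForm ![L u, L v, L w] = L.det * o.volumeForm ![u, v, w] := by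
  rw [o.volumeForm_robust (o.finOrthonormalBasis (by norm_num) finrank_euclideanSpace_fin)
    (o.finOrthonormalBasis_orientation _ _)]
  have e : ![L u, L v, L w] = (L : R3 →ₗ[ℝ] R3) ∘ ![u, v, w] := by
    ext i : 1
    fin_cases i <;> rfl
  rw [e, Module.Basis.det_comp]

namespace RMetric

variable {g : RMetric}

theorem sharp_apply (x : R3) (a : R3 →L[ℝ] ℝ) (i : Fin 3) :
    g.sharp x a i = ∑ j, (g.gram x)⁻¹ i j * a (coordVec j) := by
  simp [sharp, coordVec_apply]

theorem inner_sharp (x : R3) (a : R3 →L[ℝ] ℝ) (u : R3) : g.inner x (g.sharp x a) u = a u := by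
  have h : g.gram x * (g.gram x)⁻¹ = 1 :=
    Matrix.mul_nonsing_inv _ (g.gram_det_pos x).ne'.isUnit
  set T : Fin 3 → ℝ := fun j ↦ a (coordVec j) with hT
  have h2 : ∀ k, (g.gram x).mulVec ((g.gram x)⁻¹.mulVec T) k = T k := fun k ↦ by
    rw [Matrix.mulVec_mulVec, h, Matrix.one_mulVec]
  rw [apply_eq_sum_coordVec a, g.inner_eq_sum, Finset.sum_comm]
  refine Finset.sum_congr rfl fun k _ ↦ ?_
  change _ = u k * T k
  rw [← h2 k]
  simp only [Matrix.mulVec, dotProduct, sharp_apply, Finset.mul_sum, Finset.sum_mul]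
  refine Finset.sum_congr rfl fun i _ ↦ Finset.sum_congr rfl fun j _ ↦ ?_
  rw [g.gram_symm x k i]
  ring

theorem coinner_self (x : R3) (a : R3 →L[ℝ] ℝ) : g.coinner x a a = a (g.sharp x a) := by
  rw [apply_eq_sum_coordVec a, coinner]
  simp only [sharp_apply, Finset.sum_mul]
  exact Finset.sum_congr rfl fun i _ ↦ Finset.sum_congr rfl fun j _ ↦ by ring

namespace IsDeveloping

variable {F : R3 → R3}

theorem injective_fderiv (hF : g.IsDeveloping F) (x : R3) :
    Function.Injective (fderiv ℝ F x) := by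
  refine (injective_iff_map_eq_zero _).2 fun v hv ↦ ?_
  by_contra hne
  have h := g.pos x v hne
  rw [← hF.inner_fderiv, hv, inner_zero_left] at h
  exact lt_irrefl _ h

/-- The differential of a developing map as a linear equivalence. -/
def fderivEquiv (hF : g.IsDeveloping F) (x : R3) : R3 ≃L[ℝ] R3 :=
  (LinearEquiv.ofInjectiveEndo (fderiv ℝ F x : R3 →ₗ[ℝ] R3)
    (hF.injective_fderiv x)).toContinuousLinearEquiv

theorem coe_fderivEquiv (hF : g.IsDeveloping F) (x : R3) :
    (hF.fderivEquiv x : R3 →L[ℝ] R3) = fderiv ℝ F x := by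
  ext1 v
  rfl

theorem fderivEquiv_apply (hF : g.IsDeveloping F) (x v : R3) :
    hF.fderivEquiv x v = fderiv ℝ F x v := rfl

theorem isLocalDiffeomorph (hF : g.IsDeveloping F) :
    IsLocalDiffeomorph 𝓘(ℝ, R3) 𝓘(ℝ, R3) ∞ F :=
  isLocalDiffeomorph_of_fderiv_equiv hF.contDiff hF.fderivEquiv
    fun x ↦ (hF.coe_fderivEquiv x).symm

theorem contDiff_fderiv (hF : g.IsDeveloping F) : ContDiff ℝ ∞ (fderiv ℝ F) :=
  hF.contDiff.fderiv_right (by simp)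

theorem contDiff_symm (hF : g.IsDeveloping F) :
    ContDiff ℝ ∞ fun x ↦ ((hF.fderivEquiv x).symm : R3 →L[ℝ] R3) := by
  have h : ∀ x, ((hF.fderivEquiv x).symm : R3 →L[ℝ] R3)
      = ContinuousLinearMap.inverse (fderiv ℝ F x) := fun x ↦ by
    rw [← hF.coe_fderivEquiv, ContinuousLinearMap.inverse_equiv]
  simp only [h]
  refine contDiff_iff_contDiffAt.2 fun x ↦ ?_
  refine ContDiffAt.comp (g := ContinuousLinearMap.inverse) x ?_ hF.contDiff_fderiv.contDiffAt
  rw [← hF.coe_fderivEquiv]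
  exact contDiffAt_map_inverse _

theorem det_gram (hF : g.IsDeveloping F) (x : R3) :
    (g.gram x).det = (fderiv ℝ F x).det ^ 2 := by
  set M := LinearMap.toMatrix (EuclideanSpace.basisFun (Fin 3) ℝ).toBasis
    (EuclideanSpace.basisFun (Fin 3) ℝ).toBasis (fderiv ℝ F x : R3 →ₗ[ℝ] R3) with hM
  have h1 : g.gram x = M.transpose * M := by
    ext i j
    rw [gram, Matrix.of_apply, ← hF.inner_fderiv, Matrix.mul_apply]
    simp only [PiLp.inner_apply, RCLike.inner_apply, conj_trivial, hM, Matrix.transpose_apply,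
      LinearMap.toMatrix_apply]
    refine Finset.sum_congr rfl fun a _ ↦ ?_
    simp [coordVec, mul_comm]
  have h2 : M.det = (fderiv ℝ F x).det := LinearMap.det_toMatrix _ _
  rw [h1, Matrix.det_mul, Matrix.det_transpose, h2, sq]

/-- Since `g` has Gram determinant `(det dF)²`, the root is `|det dF|`; `det dF` is continuous and
never zero, so its sign is constant. -/
theorem exists_sign (hF : g.IsDeveloping F) :
    ∃ s : ℝ, s * s = 1 ∧ ∀ x, √(g.gram x).det = s * (fderiv ℝ F x).det := by
  have hne : ∀ x, (fderiv ℝ F x).det ≠ 0 := fun x h ↦ by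
    have := g.gram_det_pos x
    rw [hF.det_gram, h] at this
    simp at this
  have hc : Continuous fun x ↦ (fderiv ℝ F x).det :=
    ContinuousLinearMap.continuous_det.comp hF.contDiff_fderiv.continuous
  simp only [hF.det_gram, Real.sqrt_sq_eq_abs]
  by_cases h : ∀ x, 0 ≤ (fderiv ℝ F x).det
  · exact ⟨1, by norm_num, fun x ↦ by rw [abs_of_nonneg (h x), one_mul]⟩
  · push Not at h
    obtain ⟨y, hy⟩ := h
    refine ⟨-1, by norm_num, fun x ↦ ?_⟩
    rw [abs_of_nonpos, neg_one_mul]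
    by_contra! hx
    obtain ⟨z, hz⟩ := mem_range_of_exists_le_of_exists_ge hc ⟨y, hy.le⟩ ⟨x, hx.le⟩
    exact hne z hz

/-- An adapted contact form is, in a flat developing map, a unit Beltrami field. -/
theorem exists_isBeltramiField (hF : g.IsDeveloping F) {o : Orientation ℝ R3 (Fin 3)}
    {ξ : R3 → Submodule ℝ R3} {lam : ℝ} {α : R3 → R3 →L[ℝ] ℝ} (hα : IsAdaptedForm g o ξ lam α)
    {s : ℝ} (hs : ∀ x, √(g.gram x).det = s * (fderiv ℝ F x).det) :
    ∃ b A C, IsBeltramiField o (2 * lam * s) (fderiv ℝ F) b A C ∧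
      ∀ x u, ⟪b x, fderiv ℝ F x u⟫_ℝ = α x u := by
  have hαs := hα.contact.1
  have hαd : Differentiable ℝ α := hαs.differentiable (by simp)
  set J : R3 → R3 →L[ℝ] R3 := fun x ↦ ((hF.fderivEquiv x).symm : R3 →L[ℝ] R3) with hJ
  have hJs : ContDiff ℝ ∞ J := hF.contDiff_symm
  have hJP : ∀ x u, J x (fderiv ℝ F x u) = u := fun x u ↦
    (hF.fderivEquiv x).symm_apply_apply u
  have hPJ : ∀ x u, fderiv ℝ F x (J x u) = u := fun x u ↦
    (hF.fderivEquiv x).apply_symm_apply u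
  -- The Euclidean dual of `α` transported by `dF`.
  set b : R3 → R3 := fun x ↦ ∑ a, α x (J x (coordVec a)) • coordVec a with hb
  have hbs : ContDiff ℝ ∞ b := ContDiff.sum fun a _ ↦
    (hαs.clm_apply (hJs.clm_apply contDiff_const)).smul contDiff_const
  have hbd : Differentiable ℝ b := hbs.differentiable (by simp)
  have hbJ : ∀ x v, ⟪b x, v⟫_ℝ = α x (J x v) := fun x v ↦ by
    have h1 := apply_eq_sum_coordVec ((α x).comp (J x)) v
    rw [ContinuousLinearMap.comp_apply] at h1
    rw [h1, hb, sum_inner]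
    refine Finset.sum_congr rfl fun a _ ↦ ?_
    rw [real_inner_smul_left, coordVec, EuclideanSpace.inner_single_left]
    simp [mul_comm]
  have hbP : ∀ x u, ⟪b x, fderiv ℝ F x u⟫_ℝ = α x u := fun x u ↦ by rw [hbJ, hJP]
  have hdbs : ContDiff ℝ ∞ (fderiv ℝ b) := hbs.fderiv_right (by simp)
  have hFd := hF.contDiff_fderiv.differentiable (by simp)
  set A : R3 → R3 →L[ℝ] R3 := fun x ↦ (fderiv ℝ b x).comp (J x) with hA
  have hAs : ContDiff ℝ ∞ A := hdbs.clm_comp hJs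
  have hAd : Differentiable ℝ A := hAs.differentiable (by simp)
  have hAP : ∀ x u, A x (fderiv ℝ F x u) = fderiv ℝ b x u := fun x u ↦ by
    rw [hA, ContinuousLinearMap.comp_apply, hJP]
  set C : R3 → R3 →L[ℝ] R3 →L[ℝ] R3 := fun x ↦ (fderiv ℝ A x).comp (J x) with hC
  have symmF : ∀ x h k, fderiv ℝ (fderiv ℝ F) x h k = fderiv ℝ (fderiv ℝ F) x k h :=
    fun x h k ↦ ((contDiff_infty.1 hF.contDiff 2).contDiffAt.isSymmSndFDerivAt (by simp)).eq h k
  have symmb : ∀ x h k, fderiv ℝ (fderiv ℝ b) x h k = fderiv ℝ (fderiv ℝ b) x k h :=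
    fun x h k ↦ ((contDiff_infty.1 hbs 2).contDiffAt.isSymmSndFDerivAt (by simp)).eq h k
  have hPk : ∀ x k, HasFDerivAt (fun y ↦ fderiv ℝ F y k) ((fderiv ℝ (fderiv ℝ F) x).flip k) x :=
    fun x k ↦ by
      refine ((hFd x).hasFDerivAt.clm_apply (hasFDerivAt_const k x)).congr_fderiv ?_
      ext1; simp
  -- Product rule for `db = A ∘ dF`. The terms with the second derivative of `F` are symmetric, here
  -- and in `hdα`, so they drop out of the symmetry of `C` and out of `dα`.
  have hD2b : ∀ x h k, fderiv ℝ (fderiv ℝ b) x h k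
      = fderiv ℝ A x h (fderiv ℝ F x k) + A x (fderiv ℝ (fderiv ℝ F) x h k) := fun x h k ↦ by
    have h1 := (hAd x).hasFDerivAt.clm_apply (hPk x k)
    simp only [hAP] at h1
    have h2 := ((hdbs.differentiable (by simp) x).hasFDerivAt.clm_apply (hasFDerivAt_const k x))
    have := congrArg (fun L ↦ L h) (h2.unique h1)
    simp only [add_apply, ContinuousLinearMap.comp_apply, ContinuousLinearMap.flip_apply,
      zero_apply, map_zero, zero_add] at this
    rw [this, add_comm]
  have hdα : ∀ x h k, fderiv ℝ α x h k
      = ⟪A x (fderiv ℝ F x h), fderiv ℝ F x k⟫_ℝ + ⟪b x, fderiv ℝ (fderiv ℝ F) x h k⟫_ℝ :=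
    fun x h k ↦ by
      have h1 := (hbd x).hasFDerivAt.inner ℝ (hPk x k)
      simp only [hbP] at h1
      have h2 := (hαd x).hasFDerivAt.clm_apply (hasFDerivAt_const k x)
      have := congrArg (fun L ↦ L h) (h2.unique h1)
      simp only [add_apply, ContinuousLinearMap.comp_apply, ContinuousLinearMap.flip_apply,
        zero_apply, map_zero, zero_add, fderivInnerCLM_apply,
        ContinuousLinearMap.prod_apply] at this
      rw [this, hAP, add_comm]
  have hPsharp : ∀ x, fderiv ℝ F x (g.sharp x (α x)) = b x := fun x ↦ by
    refine ext_inner_right ℝ fun v ↦ ?_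
    rw [← hPJ x v, hF.inner_fderiv, inner_sharp, hbP]
  refine ⟨b, A, C, ⟨fun x ↦ (hF.fderivEquiv x).surjective, fun x ↦ ?_, fun x ↦ ?_,
    fun x u v ↦ ?_, fun x ↦ ?_, fun x u v ↦ ?_⟩, hbP⟩
  · refine (hbd x).hasFDerivAt.congr_fderiv ?_
    ext1 u
    rw [ContinuousLinearMap.comp_apply, hAP]
  · refine (hAd x).hasFDerivAt.congr_fderiv ?_
    ext1 u
    rw [hC, ContinuousLinearMap.comp_apply, ContinuousLinearMap.comp_apply, hJP]
  · have h1 := symmb x (J x u) (J x v)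
    rw [hD2b, hD2b, symmF x (J x u), hPJ, hPJ] at h1
    exact add_right_cancel h1
  · have h1 := hα.unit x
    rwa [coinner_self, ← hbP, hPsharp] at h1
  · have h1 := hα.d_eq x (J x u) (J x v)
    rw [d_apply hαd, hdα, hdα, symmF x (J x u), hPJ, hPJ, hodgeStar, vol, hs] at h1
    have h2 := volumeForm_map o (fderiv ℝ F x) (g.sharp x (α x)) (J x u) (J x v)
    rw [hPJ, hPJ, hPsharp] at h2
    rw [volLeft_apply, h2]
    linarith

end IsDeveloping

end RMetric

/-! ### Completeness and bijectivity of the developing map -/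

namespace RMetric.IsDeveloping

variable {g : RMetric} {F : R3 → R3}

/-- A developing map sends geodesics to affinely parametrised straight lines. -/
theorem apply_geodesic (hF : g.IsDeveloping F) {γ : ℝ → R3} (hγ : g.IsGeodesic γ) (t : ℝ) :
    F (γ t) = F (γ 0) + t • fderiv ℝ F (γ 0) (deriv γ 0) := by
  have hγd : ∀ t, HasDerivAt γ (deriv γ t) t := fun t ↦
    (hγ.1.differentiable (by simp) t).hasDerivAt
  have hγ' : ContDiff ℝ ∞ (deriv γ) := contDiff_infty_iff_deriv.1 hγ.1 |>.2
  have hγ'd : ∀ t, HasDerivAt (deriv γ) (deriv (deriv γ) t) t := fun t ↦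
    (hγ'.differentiable (by simp) t).hasDerivAt
  -- By the equation for the second derivative of `F`, `(F ∘ γ)'' = dF (γ'' + Γ(γ', γ'))`, which the
  -- geodesic equation makes zero.
  have hv : ∀ t, HasDerivAt (fun t ↦ fderiv ℝ F (γ t) (deriv γ t)) 0 t := fun t ↦ by
    have h1 : HasDerivAt (fun t ↦ fderiv ℝ F (γ t)) (fderiv ℝ (fderiv ℝ F) (γ t) (deriv γ t)) t :=
      (hF.contDiff_fderiv.differentiable (by simp) (γ t)).hasFDerivAt.comp_hasDerivAt t (hγd t)
    refine (h1.clm_apply (hγ'd t)).congr_deriv ?_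
    ext a
    have h2 : fderiv ℝ F (γ t) (deriv (deriv γ) t) a
        = ∑ l, (deriv (deriv γ) t) l * fderiv ℝ F (γ t) (coordVec l) a :=
      apply_eq_sum_coordVec ((EuclideanSpace.proj a : R3 →L[ℝ] ℝ).comp (fderiv ℝ F (γ t))) _
    rw [PiLp.add_apply, hF.fderiv_fderiv, h2, ← Finset.sum_add_distrib, PiLp.zero_apply]
    refine Finset.sum_eq_zero fun l _ ↦ ?_
    rw [← add_mul, add_comm, hγ.2 t l, zero_mul]
  have hconst : ∀ t, fderiv ℝ F (γ t) (deriv γ t) = fderiv ℝ F (γ 0) (deriv γ 0) := fun t ↦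
    is_const_of_deriv_eq_zero (fun t ↦ (hv t).differentiableAt) (fun t ↦ (hv t).deriv) t 0
  have hc : ∀ t, HasDerivAt (fun t ↦ F (γ t) - t • fderiv ℝ F (γ 0) (deriv γ 0)) 0 t := fun t ↦ by
    have h1 : HasDerivAt (fun t ↦ F (γ t)) (fderiv ℝ F (γ t) (deriv γ t)) t :=
      (hF.contDiff.differentiable (by simp) (γ t)).hasFDerivAt.comp_hasDerivAt t (hγd t)
    refine (h1.sub ((hasDerivAt_id t).smul_const _)).congr_deriv ?_
    rw [hconst, one_smul, sub_self]
  have := is_const_of_deriv_eq_zero (fun t ↦ (hc t).differentiableAt) (fun t ↦ (hc t).deriv) t 0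
  rw [zero_smul, sub_zero] at this
  rw [← this]
  abel

/-- A developing map of a complete flat metric has a continuous section, obtained by lifting
straight lines through one point to geodesics. -/
theorem exists_section (hF : g.IsDeveloping F) (hg : g.IsComplete) :
    ∃ G : R3 → R3, Continuous G ∧ ∀ q, F (G q) = q := by
  choose γ hγ hγ0 hγ1 using fun q ↦ hg 0 ((hF.fderivEquiv 0).symm (q - F 0))
  have hline : ∀ q t, F (γ q t) = F 0 + t • (q - F 0) := fun q t ↦ by
    rw [hF.apply_geodesic (hγ q), hγ0, hγ1, ← hF.fderivEquiv_apply,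
      ContinuousLinearEquiv.apply_symm_apply]
  -- The geodesics depend on `q` by mere choice; joint continuity holds because each lifts its line
  -- through a local homeomorphism with Hausdorff source, from a common start.
  have hc := hF.isLocalDiffeomorph.isLocalHomeomorph.continuous_lift (T2Space.isSeparatedMap F)
    (A := R3) (f := ⟨fun p : unitInterval × R3 ↦ F 0 + (p.1 : ℝ) • (p.2 - F 0), by fun_prop⟩)
    (g := fun p ↦ γ p.2 p.1) (by ext1 p; exact hline _ _)
    (by simpa [hγ0] using continuous_const)
    (fun q ↦ (hγ q).1.continuous.comp continuous_subtype_val)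
  refine ⟨fun q ↦ γ q 1, hc.comp (Continuous.prodMk_right (1 : unitInterval)), fun q ↦ ?_⟩
  rw [hline, one_smul, add_sub_cancel]

/-- The image of a continuous section of a local homeomorphism is open, and it is closed as the set
where `G ∘ F` is the identity. By connectedness `G` is onto, so `F` is injective. -/
theorem bijective (hF : g.IsDeveloping F) (hg : g.IsComplete) : Function.Bijective F := by
  obtain ⟨G, hG, hFG⟩ := hF.exists_section hg
  have hcomp : F ∘ G = id := funext hFG
  have hopen : IsOpen (range G) :=
    (hF.isLocalDiffeomorph.isLocalHomeomorph.isOpenEmbedding_of_comp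
      (hcomp ▸ Topology.IsOpenEmbedding.id) hG).isOpen_range
  have hclosed : IsClosed (range G) := by
    have : range G = {x | G (F x) = x} := by
      ext x
      exact ⟨by rintro ⟨q, rfl⟩; exact congrArg G (hFG q), fun h ↦ ⟨F x, h⟩⟩
    rw [this]
    exact isClosed_eq (hG.comp hF.contDiff.continuous) continuous_id
  have huniv : range G = univ := IsClopen.eq_univ ⟨hclosed, hopen⟩ (range_nonempty G)
  refine ⟨fun x y hxy ↦ ?_, fun q ↦ ⟨G q, hFG q⟩⟩
  obtain ⟨p, rfl⟩ := huniv.symm ▸ mem_univ x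
  obtain ⟨q, rfl⟩ := huniv.symm ▸ mem_univ y
  rw [hFG, hFG] at hxy
  rw [hxy]

/-- A linear isometry after a developing map is a developing map. -/
theorem comp_isometry (hF : g.IsDeveloping F) (L : R3 ≃ₗᵢ[ℝ] R3) :
    g.IsDeveloping (fun x ↦ L (F x)) ∧ ∀ x u, fderiv ℝ (fun x ↦ L (F x)) x u
      = L (fderiv ℝ F x u) := by
  have hd : ∀ x, fderiv ℝ (fun x ↦ L (F x)) x
      = (L.toContinuousLinearEquiv : R3 →L[ℝ] R3).comp (fderiv ℝ F x) := fun x ↦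
    ((L.toContinuousLinearEquiv : R3 →L[ℝ] R3).hasFDerivAt.comp x
      (hF.contDiff.differentiable (by simp) x).hasFDerivAt).fderiv
  have hd1 : ∀ x u, fderiv ℝ (fun x ↦ L (F x)) x u = L (fderiv ℝ F x u) := fun x u ↦ by
    rw [hd]; rfl
  have hd2 : ∀ x u v, fderiv ℝ (fderiv ℝ (fun x ↦ L (F x))) x u v
      = L (fderiv ℝ (fderiv ℝ F) x u v) := fun x u v ↦ by
    have h1 := (hasFDerivAt_const (L.toContinuousLinearEquiv : R3 →L[ℝ] R3) x).clm_comp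
      (hF.contDiff_fderiv.differentiable (by simp) x).hasFDerivAt
    rw [funext hd, h1.fderiv]
    simp
  have hsum : ∀ x u v, fderiv ℝ (fderiv ℝ F) x u v
      = ∑ l, (∑ i, ∑ k, g.christoffel l i k x * u i * v k) • fderiv ℝ F x (coordVec l) :=
    fun x u v ↦ by
      ext a
      rw [hF.fderiv_fderiv]
      simp
  refine ⟨⟨L.contDiff.comp hF.contDiff, fun x u v ↦ ?_, fun x u v a ↦ ?_⟩, hd1⟩
  · rw [hd1, hd1, L.inner_map_map, hF.inner_fderiv]
  · rw [hd2, hsum, map_sum]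
    simp [hd1]

end RMetric.IsDeveloping

/-- A flat metric with an adapted form has a developing map that pulls the standard form back to the
adapted one. -/
theorem exists_isDeveloping_pulls {g : RMetric} (hflat : g.IsFlat) {o : Orientation ℝ R3 (Fin 3)}
    {ξ : R3 → Submodule ℝ R3} {lam : ℝ} {α : R3 → R3 →L[ℝ] ℝ} (hα : IsAdaptedForm g o ξ lam α) :
    ∃ φ, g.IsDeveloping φ ∧ Pulls φ g α stdMetric (stdForm lam) := by
  obtain ⟨F, hF⟩ := hflat.exists_isDeveloping
  obtain ⟨s, hs, hdet⟩ := hF.exists_sign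
  obtain ⟨b, A, C, H, hb⟩ := hF.exists_isBeltramiField hα hdet
  have hs0 : s ≠ 0 := fun h ↦ by simp [h] at hs
  obtain ⟨B, hB⟩ := H.exists_eq_sin_cos (mul_ne_zero (mul_ne_zero two_ne_zero hα.lam_ne_zero) hs0)
    (fun x ↦ (hF.contDiff.differentiable (by simp) x).hasFDerivAt) hs
  -- Taking coordinates in `B` turns `⟪B i, F x⟫` into the `i`-th coordinate; the phase factor is
  -- `(2 * lam * s) * s = 2 * lam`.
  obtain ⟨hφ, hφ'⟩ := hF.comp_isometry B.repr
  refine ⟨_, hφ, hφ.inner_fderiv, fun x u ↦ ?_⟩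
  rw [hφ', ← hb, hB]
  rw [mul_assoc (2 * lam) s s, hs, mul_one, inner_add_left, real_inner_smul_left,
    real_inner_smul_left, ← B.repr_apply_apply, ← B.repr_apply_apply, ← B.repr_apply_apply]
  rfl

end ContactR3

end

theorem theorem4p3 (g : ContactR3.RMetric) (hflat : g.IsFlat)
    (o : Orientation ℝ ContactR3.R3 (Fin 3))
    (ξ : ContactR3.R3 → Submodule ℝ ContactR3.R3) (lam : ℝ)
    (α : ContactR3.R3 → ContactR3.R3 →L[ℝ] ℝ)
    (hα : ContactR3.IsAdaptedForm g o ξ lam α) :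
    ContactR3.LocallyContactIsometric g α ContactR3.stdMetric (ContactR3.stdForm lam) ∧
      (g.IsComplete →
        ContactR3.ContactIsometric g α ContactR3.stdMetric (ContactR3.stdForm lam)) := by
  obtain ⟨φ, hφ, hpulls⟩ := ContactR3.exists_isDeveloping_pulls hflat hα
  exact ⟨⟨φ, hφ.isLocalDiffeomorph, hpulls⟩, fun hg ↦
    ⟨hφ.isLocalDiffeomorph.diffeomorphOfBijective (hφ.bijective hg), hpulls⟩⟩
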